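/- **Setting.** Let $\mathbb K=\mathbb R$ or $\mathbb C$ and consider the semi-discrete equation $t_{1x}=f(x,t,t_1,t_x)$ for $t=t(n,x)$, where $t_k=t(n+k,x)$ $(k\in\mathbb Z$, $t_0=t)$, $t_x=\partial t/\partial x$, with $f$ analytic, and suppose that $t_x=f(x,t_{-1},t,t_{-1x})$ is solved by $t_{-1x}=g(x,t_{-1},t,t_x)$ with $g$ analytic. The variables $x$, $t_x$, $t_k$ $(k\in\mathbb Z)$ range over a nonempty domain whose projections to finitely many variables are connected open sets, and which is invariant under the shift $(x,t_x,t_k)\mapsto(x,f(x,t,t_1,t_x),t_{k+1})$ and its inverse $(x,t_x,t_k)\mapsto(x,g(x,t_{-1},t,t_x),t_{k-1})$. Let $\mathcal F$ be the field of quotients of analytic functions on this domain depending on finitely many of the variables, and let $D:\mathcal F\to\mathcal F$ be the shift automorphism: $Dx=x$, $Dt_k=t_{k+1}$, $Dt_x=f$, hence $D^{-1}t_x=g$. Put $$X=\frac{\partial}{\partial t_x},\qquad K=\frac{\partial}{\partial x}+\sum_{k\in\mathbb Z}(D^kt_x)\frac{\partial}{\partial t_k}=\frac{\partial}{\partial x}+t_x\frac{\partial}{\partial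 t}+f\frac{\partial}{\partial t_1}+g\frac{\partial}{\partial t_{-1}}+(Df)\frac{\partial}{\partial t_2}+\cdots,$$ $C_1=[X,K]$, $C_2=[X,C_1]$, $Z_1=[K,C_1]$. The characteristic $x$-ring $L_x$ is the smallest set of vector fields (derivations of $\mathcal F$) that contains $X$ and $K$ and is closed under $\mathcal F$-linear combinations and commutators. Put $$p=\frac{f_x+t_xf_t+ff_{t_1}}{f_{t_x}},\quad v=f_t+f_{t_x}f_{t_1},\quad w=f_{xt_x}+t_xf_{t_xt}+ff_{t_xt_1},\quad h=f_{t_xt_xt_x}f_{t_x}-3f_{t_xt_x}^2 .$$ For coefficients $E_{11},E_{12},E_{22},E_{23},E_{24},E_{32},E_{34},F_1,F_2,F_3\in\mathcal F$ of a system $$E_{11}u+E_{12}Du=F_1,\qquad E_{22}Du+E_{23}y+E_{24}Dy=F_2,\qquad E_{32}Du+E_{34}Dy=F_3$$ with unknowns $u,y$ let $$\Delta=-E_{11}E_{22}E_{34}(D^{-1}E_{34})+E_{11}E_{24}E_{32}(D^{-1}E_{34})-E_{12}E_{23}E_{34}(D^{-1}E_{32}),$$ $$H=\frac{(F_1E_{24}E_{32}-F_1E_{22}E_{34}+F_2E_{12}E_{34}-F_3E_{12}E_{24})(D^{-1}E_{34})-(D^{-1}F_3)E_{12}E_{23}E_{34}}{\Delta},\qquad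 V=\frac{D^{-1}F_3-(D^{-1}E_{32})H}{D^{-1}E_{34}} .$$ Write $\Delta^{(i)},H^{(i)},V^{(i)}$ for these expressions formed from the following three systems (division by $0$ being given the value $0$). In all three $$E_{12}^{(i)}=-1,\quad E_{22}^{(i)}=p,\quad E_{24}^{(i)}=-\frac1{f_{t_x}},\quad E_{32}^{(i)}=w-v-pf_{t_xt_x},\quad E_{34}^{(i)}=\frac{f_{t_xt_x}}{f_{t_x}} .$$ (1) ($u=\beta$, $y=\alpha$, from $[X,C_2]=\alpha C_2+\beta Z_1$) $E_{11}^{(1)}=E_{23}^{(1)}=\frac1{f_{t_x}^2}$, $F_1^{(1)}=0$, $F_2^{(1)}=\frac{3f_{t_xt_x}}{f_{t_x}^3}$, $F_3^{(1)}=\frac{h}{f_{t_x}^3}$; put $\beta=H^{(1)}$, $\alpha=V^{(1)}$. (2) ($u=\mu$, $y=\gamma$, from $[K,C_2]=\gamma C_2+\mu Z_1$) $E_{11}^{(2)}=E_{23}^{(2)}=\frac1{f_{t_x}}$, $F_1^{(2)}=\frac{f_{t_xt_x}}{f_{t_x}^2}+\frac{p\beta}{f_{t_x}}$, $F_2^{(2)}=\frac{2w-p(3f_{t_xt_x}-f_{t_x}\alpha)}{f_{t_x}^2}$,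 $$F_3^{(2)}=\frac{-3f_{t_xt_x}w+f_tf_{t_xt_x}-ph}{f_{t_x}^2}+\frac{f_{xt_xt_x}+t_xf_{tt_xt_x}+ff_{t_xt_xt_1}}{f_{t_x}};$$ put $\mu=H^{(2)}$, $\gamma=V^{(2)}$. (3) ($u=\sigma$, $y=\eta$, from $[K,Z_1]=\eta C_2+\sigma Z_1$) $E_{11}^{(3)}=E_{23}^{(3)}=1$, $F_1^{(3)}=p\bigl(2\mu-p\beta-\frac{2f_{t_xt_x}}{f_{t_x}}\bigr)+\frac{2w-v}{f_{t_x}}$, $F_2^{(3)}=p(2\gamma-p\alpha)+K(p)+\frac{3p^2f_{t_xt_x}-3pw}{f_{t_x}}$, $$F_3^{(3)}=-(K-pX)(f_{t_xt_x}p+v-w)+(f_{t_xt_x}p+v-w)\frac{2w-f_t-2pf_{t_xt_x}}{f_{t_x}} .$$ **Theorem.** Assume $f_{t_xt_x}\neq0$ in $\mathcal F$. Then $L_x$ is five-dimensional over $\mathcal F$ with basis $X,K,C_1,C_2,Z_1$ if and only if for $i=1,2,3$ $$\Delta^{(i)}\neq0\qquad\text{and}\qquad D H^{(i)}=\frac{F_1^{(i)}}{E_{12}^{(i)}}-\frac{E_{11}^{(i)}}{E_{12}^{(i)}}H^{(i)}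 .$$ -/

import Mathlib

/-- The dynamical variables: `x`, `t_x`, and the shifts `t_k = t(n+k, x)`, `k ∈ ℤ`
(so `t_0 = t`). -/
inductive DynVar : Type
  | x : DynVar
  | tx : DynVar
  | t : ℤ → DynVar
  deriving DecidableEq

/-- A hyperbolic semi-discrete equation `t_{1x} = f(x, t, t_1, t_x)` with analytic right-hand side,
together with its inverse form `t_{-1x} = g(x, t_{-1}, t, t_x)` and a domain on which the shift
`D` of the discrete variable and its inverse are defined.

The arguments of `f` are listed as `![x, t, t_1, t_x]`, those of `g` as `![x, t_{-1}, t, t_x]`.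
`domain` is a set of values of all the dynamical variables; its projections to finitely many
variables are connected open sets, so that it has analytic functions of finitely many
dynamical variables, and they form an integral domain. -/
structure SemiDiscreteEquation (𝕜 : Type*) [RCLike 𝕜] where
  f : (Fin 4 → 𝕜) → 𝕜
  g : (Fin 4 → 𝕜) → 𝕜
  domain : Set (DynVar → 𝕜)
  nonempty : domain.Nonempty
  isOpen_proj : ∀ s : Finset DynVar, IsOpen (s.restrict '' domain)
  isPreconnected_proj : ∀ s : Finset DynVar, IsPreconnected (s.restrict '' domain)
  analytic_f : AnalyticOnNhd 𝕜 f
    ((fun p : DynVar → 𝕜 => ![p .x, p (.t 0), p (.t 1), p .tx]) '' domain)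
  analytic_g : AnalyticOnNhd 𝕜 g
    ((fun p : DynVar → 𝕜 => ![p .x, p (.t (-1)), p (.t 0), p .tx]) '' domain)
  /-- Solving `t_x = f(x, t_{-1}, t, t_{-1x})` for `t_{-1x}` gives `g`. -/
  f_g : ∀ p ∈ domain, f ![p .x, p (.t (-1)), p (.t 0),
    g ![p .x, p (.t (-1)), p (.t 0), p .tx]] = p .tx
  g_f : ∀ p ∈ domain, g ![p .x, p (.t 0), p (.t 1),
    f ![p .x, p (.t 0), p (.t 1), p .tx]] = p .tx
  /-- The domain is invariant under the shift `t_k ↦ t_{k+1}`, `t_x ↦ f`. -/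
  shift_mem : ∀ p ∈ domain, (fun i : DynVar => match i with
    | .x => p .x
    | .tx => f ![p .x, p (.t 0), p (.t 1), p .tx]
    | .t k => p (.t (k + 1))) ∈ domain
  /-- The domain is invariant under the inverse shift `t_k ↦ t_{k-1}`, `t_x ↦ g`. -/
  unshift_mem : ∀ p ∈ domain, (fun i : DynVar => match i with
    | .x => p .x
    | .tx => g ![p .x, p (.t (-1)), p (.t 0), p .tx]
    | .t k => p (.t (k - 1))) ∈ domain

section FractionField

set_option linter.unusedSectionVars false

variable {k R : Type*} (F : Type*) [CommRing k] [CommRing R] [IsDomain R] [Field F] [Algebra R F]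
  [IsFractionRing R F] [Algebra k R] [Algebra k F] [IsScalarTower k R F]

/-- The ring homomorphism `a ↦ a + ε d(a)` given by a derivation `d`. -/
def Derivation.toDual (d : Derivation k R R) : R →+* TrivSqZeroExt F F where
  toFun a := TrivSqZeroExt.inl (algebraMap R F a) + TrivSqZeroExt.inr (algebraMap R F (d a))
  map_one' := by ext <;> simp
  map_zero' := by ext <;> simp
  map_add' a b := by
    ext
    · simp
    · simp only [TrivSqZeroExt.snd_add, TrivSqZeroExt.snd_inl, TrivSqZeroExt.snd_inr, zero_add,
        map_add]
  map_mul' a b := by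
    ext
    · simp
    · simp only [TrivSqZeroExt.snd_add, TrivSqZeroExt.snd_mul, TrivSqZeroExt.fst_add,
        TrivSqZeroExt.fst_inl, TrivSqZeroExt.fst_inr, TrivSqZeroExt.snd_inl,
        TrivSqZeroExt.snd_inr, zero_add, add_zero, op_smul_eq_smul, Derivation.leibniz, map_add,
        smul_eq_mul, map_mul]

theorem Derivation.isUnit_toDual (d : Derivation k R R) (y : nonZeroDivisors R) :
    IsUnit (d.toDual F y) := by
  rw [TrivSqZeroExt.isUnit_iff_isUnit_fst]
  simpa only [Derivation.toDual, RingHom.coe_mk, MonoidHom.coe_mk, OneHom.coe_mk,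
    TrivSqZeroExt.fst_add, TrivSqZeroExt.fst_inl, TrivSqZeroExt.fst_inr, add_zero] using
    IsLocalization.map_units F y

/-- The extension of `Derivation.toDual` to the field of fractions. -/
noncomputable def Derivation.toDualFrac (d : Derivation k R R) : F →+* TrivSqZeroExt F F :=
  IsLocalization.lift (d.isUnit_toDual F)

theorem Derivation.toDualFrac_algebraMap (d : Derivation k R R) (a : R) :
    d.toDualFrac F (algebraMap R F a) =
      TrivSqZeroExt.inl (algebraMap R F a) + TrivSqZeroExt.inr (algebraMap R F (d a)) :=
  IsLocalization.lift_eq (d.isUnit_toDual F) a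

theorem Derivation.fst_toDualFrac (d : Derivation k R R) (z : F) :
    (d.toDualFrac F z).fst = z := by
  have : ((TrivSqZeroExt.fstHom F F F : TrivSqZeroExt F F →+* F).comp (d.toDualFrac F)) =
      RingHom.id F :=
    IsLocalization.ringHom_ext (nonZeroDivisors R) (by
      ext a
      simp [d.toDualFrac_algebraMap F])
  exact congrArg (fun h : F →+* F => h z) this

/-- The extension of a derivation `d` of an integral domain to its field of fractions (it is the
unique one: see `Derivation.toFrac_algebraMap`). -/
noncomputable def Derivation.toFrac (d : Derivation k R R) : Derivation k F F :=
  Derivation.mk'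
    { toFun := fun z => (d.toDualFrac F z).snd
      map_add' := fun a b => by rw [map_add, TrivSqZeroExt.snd_add]
      map_smul' := fun c z => by
        have h1 : (d.toDualFrac F (algebraMap k F c)).snd = 0 := by
          rw [IsScalarTower.algebraMap_apply k R F c, d.toDualFrac_algebraMap F]
          simp
        rw [Algebra.smul_def, map_mul, TrivSqZeroExt.snd_mul, d.fst_toDualFrac F, h1,
          smul_zero, add_zero, RingHom.id_apply, algebraMap_smul] }
    (fun a b => by
      change (d.toDualFrac F (a * b)).snd = a • (d.toDualFrac F b).snd + b • (d.toDualFrac F a).snd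
      rw [map_mul, TrivSqZeroExt.snd_mul, d.fst_toDualFrac F, d.fst_toDualFrac F, op_smul_eq_smul])

theorem Derivation.toFrac_algebraMap (d : Derivation k R R) (a : R) :
    d.toFrac F (algebraMap R F a) = algebraMap R F (d a) :=
  (congrArg TrivSqZeroExt.snd (d.toDualFrac_algebraMap F a)).trans (by
    simp only [TrivSqZeroExt.snd_add, TrivSqZeroExt.snd_inl, TrivSqZeroExt.snd_inr, zero_add])

theorem isScalarTower_fractionRing (k R : Type*) [CommRing k] [CommRing R] [Algebra k R] :
    IsScalarTower k R (FractionRing R) := inferInstance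

end FractionField

namespace SemiDiscreteEquation

variable {𝕜 : Type*} [RCLike 𝕜] (E : SemiDiscreteEquation 𝕜)

/-! ### Analytic functions of finitely many dynamical variables -/

/-- `F` is the function `φ` of the variables in the finite set `s`, and `φ` is analytic. -/
def IsRep (F : E.domain → 𝕜) (s : Finset DynVar) (φ : (s → 𝕜) → 𝕜) : Prop :=
  AnalyticOnNhd 𝕜 φ (s.restrict '' E.domain) ∧ ∀ p : E.domain, F p = φ (s.restrict p.1)

/-- `F` is an analytic function of finitely many dynamical variables. -/
def IsLocal (F : E.domain → 𝕜) : Prop :=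
  ∃ (s : Finset DynVar) (φ : (s → 𝕜) → 𝕜), E.IsRep F s φ

variable {E} in
theorem IsRep.mono {F : E.domain → 𝕜} {s s' : Finset DynVar} {φ : (s → 𝕜) → 𝕜}
    (h : E.IsRep F s φ) (hs : s ⊆ s') :
    E.IsRep F s' (fun q => φ (fun i => q ⟨i.1, hs i.2⟩)) := by
  refine ⟨?_, fun p => by rw [h.2 p]; rfl⟩
  refine h.1.comp (t := s.restrict '' E.domain)
    (AnalyticOnNhd.pi (𝕜 := 𝕜) fun i => ?_) ?_
  · exact (ContinuousLinearMap.proj (R := 𝕜) (φ := fun _ : s' => 𝕜)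
      ⟨i.1, hs i.2⟩).analyticOnNhd _
  · rintro _ ⟨p, hp, rfl⟩
    exact ⟨p, hp, rfl⟩

theorem exists_common_rep {ι : Type*} [Finite ι] (G : ι → E.domain → 𝕜)
    (hG : ∀ i, E.IsLocal (G i)) :
    ∃ (s : Finset DynVar) (γ : ι → (s → 𝕜) → 𝕜), ∀ i, E.IsRep (G i) s (γ i) := by
  classical
  cases nonempty_fintype ι
  choose s φ h using hG
  exact ⟨Finset.univ.biUnion s, _, fun i =>
    (h i).mono (Finset.subset_biUnion_of_mem s (Finset.mem_univ i))⟩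

theorem isLocal_comp {ι : Type*} [Fintype ι] (G : ι → E.domain → 𝕜)
    (hG : ∀ i, E.IsLocal (G i)) (φ : (ι → 𝕜) → 𝕜)
    (hφ : AnalyticOnNhd 𝕜 φ (Set.range fun (p : E.domain) (i : ι) => G i p)) :
    E.IsLocal (fun p => φ (fun i => G i p)) := by
  obtain ⟨s, γ, h⟩ := E.exists_common_rep G hG
  refine ⟨s, fun q => φ (fun i => γ i q), ?_, fun p => by simp only [(h _).2 p]⟩
  refine hφ.comp (AnalyticOnNhd.pi (𝕜 := 𝕜) fun i => (h i).1) ?_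
  rintro _ ⟨p, hp, rfl⟩
  exact ⟨⟨p, hp⟩, funext fun i => (h i).2 ⟨p, hp⟩⟩

theorem isLocal_coord (i : DynVar) : E.IsLocal (fun p => p.1 i) :=
  ⟨{i}, fun q => q ⟨i, Finset.mem_singleton_self i⟩,
    (ContinuousLinearMap.proj (R := 𝕜) (φ := fun _ : ({i} : Finset DynVar) => 𝕜)
      ⟨i, Finset.mem_singleton_self i⟩).analyticOnNhd _, fun _ => rfl⟩

theorem isLocal_const (c : 𝕜) : E.IsLocal (fun _ => c) :=
  ⟨∅, fun _ => c, analyticOnNhd_const, fun _ => rfl⟩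

theorem isLocal_add {F G : E.domain → 𝕜} (hF : E.IsLocal F) (hG : E.IsLocal G) :
    E.IsLocal (F + G) := by
  obtain ⟨s, γ, h⟩ := E.exists_common_rep ![F, G] (by intro i; fin_cases i <;> assumption)
  exact ⟨s, γ 0 + γ 1, (h 0).1.add (h 1).1, fun p => congrArg₂ (· + ·) ((h 0).2 p) ((h 1).2 p)⟩

theorem isLocal_mul {F G : E.domain → 𝕜} (hF : E.IsLocal F) (hG : E.IsLocal G) :
    E.IsLocal (F * G) := by
  obtain ⟨s, γ, h⟩ := E.exists_common_rep ![F, G] (by intro i; fin_cases i <;> assumption)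
  exact ⟨s, γ 0 * γ 1, (h 0).1.mul (h 1).1, fun p => congrArg₂ (· * ·) ((h 0).2 p) ((h 1).2 p)⟩

/-- The ring of analytic functions of finitely many dynamical variables. -/
def funRing : Subalgebra 𝕜 (E.domain → 𝕜) where
  carrier := {F | E.IsLocal F}
  mul_mem' := E.isLocal_mul
  add_mem' := E.isLocal_add
  algebraMap_mem' := E.isLocal_const

instance : IsDomain E.funRing := by
  have : Nontrivial E.funRing := by
    obtain ⟨p, hp⟩ := E.nonempty
    refine ⟨⟨0, 1, fun h => ?_⟩⟩
    have := congrFun (congrArg Subtype.val h) ⟨p, hp⟩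
    simp at this
  have : NoZeroDivisors E.funRing := by
    refine ⟨fun {F G} hFG => ?_⟩
    obtain ⟨s, γ, h⟩ := E.exists_common_rep ![F.1, G.1]
      (by intro i; fin_cases i; exacts [F.2, G.2])
    have hF : ∀ p : E.domain, F.1 p = γ 0 (s.restrict p.1) := (h 0).2
    have hG : ∀ p : E.domain, G.1 p = γ 1 (s.restrict p.1) := (h 1).2
    by_contra! hne
    have h0 : ∃ p : E.domain, F.1 p ≠ 0 := by
      by_contra! hz
      exact hne.1 (Subtype.ext (funext hz))
    obtain ⟨p, hp⟩ := h0
    rw [hF] at hp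
    have hmem : s.restrict p.1 ∈ s.restrict '' E.domain := ⟨p.1, p.2, rfl⟩
    have hc : ∀ᶠ q in nhds (s.restrict p.1), γ 0 q ≠ 0 :=
      ((h 0).1 _ hmem).continuousAt.eventually_ne hp
    have ho : ∀ᶠ q in nhds (s.restrict p.1), q ∈ s.restrict '' E.domain :=
      (E.isOpen_proj s).mem_nhds hmem
    have hz : γ 1 =ᶠ[nhds (s.restrict p.1)] 0 := by
      filter_upwards [hc, ho] with q hq hq'
      obtain ⟨r, hr, rfl⟩ := hq'
      have h1 : F.1 ⟨r, hr⟩ * G.1 ⟨r, hr⟩ = 0 :=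
        congrFun (congrArg Subtype.val hFG) ⟨r, hr⟩
      rw [hF, hG] at h1
      exact (mul_eq_zero.1 h1).resolve_left hq
    have hall := (h 1).1.eqOn_zero_of_preconnected_of_eventuallyEq_zero
      (E.isPreconnected_proj s) hmem hz
    exact hne.2 (Subtype.ext (funext fun r => (hG r).trans (hall ⟨r.1, r.2, rfl⟩)))
  exact NoZeroDivisors.to_isDomain _

/-- The field of functions: quotients of analytic functions of finitely many dynamical
variables. -/
def FunField : Type _ := FractionRing E.funRing

noncomputable instance : Field E.FunField := inferInstanceAs (Field (FractionRing E.funRing))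

noncomputable instance : Algebra E.funRing E.FunField :=
  inferInstanceAs (Algebra E.funRing (FractionRing E.funRing))

instance : IsFractionRing E.funRing E.FunField :=
  inferInstanceAs (IsFractionRing E.funRing (FractionRing E.funRing))

noncomputable instance : Algebra 𝕜 E.FunField :=
  inferInstanceAs (Algebra 𝕜 (FractionRing E.funRing))

instance : IsScalarTower 𝕜 E.funRing E.FunField :=
  isScalarTower_fractionRing 𝕜 E.funRing

/-- The dynamical variable `i` as a function. -/
def coordFun (i : DynVar) : E.funRing := ⟨fun p => p.1 i, E.isLocal_coord i⟩

/-! ### The shift operator `D` -/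

/-- The shift on the domain. -/
def shiftPt (p : E.domain) : E.domain := ⟨_, E.shift_mem p.1 p.2⟩

/-- The inverse shift on the domain. -/
def unshiftPt (p : E.domain) : E.domain := ⟨_, E.unshift_mem p.1 p.2⟩

theorem unshiftPt_shiftPt (p : E.domain) : E.unshiftPt (E.shiftPt p) = p := by
  apply Subtype.ext
  funext i
  cases i with
  | x => rfl
  | tx => simpa [unshiftPt, shiftPt] using E.g_f p.1 p.2
  | t k => simp [unshiftPt, shiftPt]

theorem shiftPt_unshiftPt (p : E.domain) : E.shiftPt (E.unshiftPt p) = p := by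
  apply Subtype.ext
  funext i
  cases i with
  | x => rfl
  | tx => simpa [unshiftPt, shiftPt] using E.f_g p.1 p.2
  | t k => simp [unshiftPt, shiftPt]

theorem isLocal_f : E.IsLocal (fun p => E.f ![p.1 .x, p.1 (.t 0), p.1 (.t 1), p.1 .tx]) := by
  have := E.isLocal_comp (fun (j : Fin 4) p => p.1 (![DynVar.x, .t 0, .t 1, .tx] j))
    (fun _ => E.isLocal_coord _) E.f (E.analytic_f.mono ?_)
  · convert this using 3
    funext j; fin_cases j <;> rfl
  · rintro _ ⟨p, rfl⟩
    refine ⟨p.1, p.2, ?_⟩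
    funext j; fin_cases j <;> rfl

theorem isLocal_g : E.IsLocal (fun p => E.g ![p.1 .x, p.1 (.t (-1)), p.1 (.t 0), p.1 .tx]) := by
  have := E.isLocal_comp (fun (j : Fin 4) p => p.1 (![DynVar.x, .t (-1), .t 0, .tx] j))
    (fun _ => E.isLocal_coord _) E.g (E.analytic_g.mono ?_)
  · convert this using 3
    funext j; fin_cases j <;> rfl
  · rintro _ ⟨p, rfl⟩
    refine ⟨p.1, p.2, ?_⟩
    funext j; fin_cases j <;> rfl

theorem isLocal_comp_map {F : E.domain → 𝕜} (hF : E.IsLocal F) (S : E.domain → E.domain)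
    (hS : ∀ i, E.IsLocal (fun p => (S p).1 i)) : E.IsLocal (fun p => F (S p)) := by
  obtain ⟨s, φ, h⟩ := hF
  have := E.isLocal_comp (fun (i : s) p => (S p).1 i) (fun i => hS i) φ (h.1.mono ?_)
  · convert this using 2 with p
    exact h.2 (S p)
  · rintro _ ⟨p, rfl⟩
    exact ⟨(S p).1, (S p).2, rfl⟩

theorem isLocal_shift {F : E.domain → 𝕜} (hF : E.IsLocal F) :
    E.IsLocal (fun p => F (E.shiftPt p)) := by
  refine E.isLocal_comp_map hF _ fun i => ?_
  cases i with
  | x => exact E.isLocal_coord _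
  | tx => exact E.isLocal_f
  | t k => exact E.isLocal_coord _

theorem isLocal_unshift {F : E.domain → 𝕜} (hF : E.IsLocal F) :
    E.IsLocal (fun p => F (E.unshiftPt p)) := by
  refine E.isLocal_comp_map hF _ fun i => ?_
  cases i with
  | x => exact E.isLocal_coord _
  | tx => exact E.isLocal_g
  | t k => exact E.isLocal_coord _

/-- The shift operator on functions, `D F(x, t_x, …, t_k, …) = F(x, f, …, t_{k+1}, …)`. -/
def shiftRing : E.funRing ≃+* E.funRing where
  toFun F := ⟨fun p => F.1 (E.shiftPt p), E.isLocal_shift F.2⟩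
  invFun F := ⟨fun p => F.1 (E.unshiftPt p), E.isLocal_unshift F.2⟩
  left_inv F := by simp [shiftPt_unshiftPt]
  right_inv F := by simp [unshiftPt_shiftPt]
  map_mul' _ _ := rfl
  map_add' _ _ := rfl

/-- The shift operator `D`; its inverse `E.D.symm` is `D⁻¹`. -/
noncomputable def D : E.FunField ≃+* E.FunField :=
  IsFractionRing.ringEquivOfRingEquiv E.shiftRing

/-! ### Vector fields -/

/-- A finite set of variables on which `F` depends. -/
noncomputable def vars (F : E.funRing) : Finset DynVar := F.2.choose

/-- `F` as a function of the variables in `E.vars F`. -/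
noncomputable def rep (F : E.funRing) : (E.vars F → 𝕜) → 𝕜 := F.2.choose_spec.choose

theorem isRep_rep (F : E.funRing) : E.IsRep F.1 (E.vars F) (E.rep F) :=
  F.2.choose_spec.choose_spec

/-- The value of the vector field `∑ i, a i ∂/∂i` on `F`: at each point it is the derivative of `F`
as a function of finitely many variables along the vector `a`. -/
noncomputable def vfFun (a : DynVar → E.funRing) (F : E.funRing) : E.domain → 𝕜 :=
  fun p => fderiv 𝕜 (E.rep F) ((E.vars F).restrict p.1) (fun i => (a i).1 p)

theorem fderiv_congr {F : E.domain → 𝕜} {s s' : Finset DynVar} {φ : (s → 𝕜) → 𝕜}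
    {φ' : (s' → 𝕜) → 𝕜} (h : E.IsRep F s φ) (h' : E.IsRep F s' φ') (hs : s ⊆ s')
    (p : E.domain) (v : DynVar → 𝕜) :
    fderiv 𝕜 φ' (s'.restrict p.1) (fun i => v i) = fderiv 𝕜 φ (s.restrict p.1) (fun i => v i) := by
  let ρ : (s' → 𝕜) →L[𝕜] (s → 𝕜) :=
    ContinuousLinearMap.pi fun i => ContinuousLinearMap.proj (⟨i.1, hs i.2⟩ : s')
  have hmem : s'.restrict p.1 ∈ s'.restrict '' E.domain := ⟨p.1, p.2, rfl⟩
  have he : φ' =ᶠ[nhds (s'.restrict p.1)] φ ∘ ρ := by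
    filter_upwards [(E.isOpen_proj s').mem_nhds hmem] with q hq
    obtain ⟨r, hr, rfl⟩ := hq
    exact (h'.2 ⟨r, hr⟩).symm.trans (h.2 ⟨r, hr⟩)
  have hd : DifferentiableAt 𝕜 φ (ρ (s'.restrict p.1)) :=
    (h.1 _ ⟨p.1, p.2, rfl⟩).differentiableAt
  rw [he.fderiv_eq, fderiv_comp _ hd ρ.differentiableAt, ρ.fderiv]
  rfl

theorem vfFun_eq (a : DynVar → E.funRing) (F : E.funRing) {s : Finset DynVar}
    {φ : (s → 𝕜) → 𝕜} (h : E.IsRep F.1 s φ) (p : E.domain) :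
    E.vfFun a F p = fderiv 𝕜 φ (s.restrict p.1) (fun i => (a i).1 p) := by
  have h1 := E.fderiv_congr (E.isRep_rep F) ((E.isRep_rep F).mono Finset.subset_union_left)
    (Finset.subset_union_left (s₂ := s)) p (fun i => (a i).1 p)
  have h2 := E.fderiv_congr h ((E.isRep_rep F).mono Finset.subset_union_left)
    (Finset.subset_union_right (s₁ := E.vars F)) p (fun i => (a i).1 p)
  exact h1.symm.trans h2

theorem isLocal_vfFun (a : DynVar → E.funRing) (F : E.funRing) : E.IsLocal (E.vfFun a F) := by
  have hpd : ∀ i : E.vars F, E.IsLocal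
      (fun p => fderiv 𝕜 (E.rep F) ((E.vars F).restrict p.1) (Pi.single i 1)) := fun i =>
    ⟨E.vars F, fun q => fderiv 𝕜 (E.rep F) q (Pi.single i 1),
      ((ContinuousLinearMap.apply 𝕜 𝕜 (Pi.single i (1 : 𝕜) : E.vars F → 𝕜)).comp_analyticOnNhd
        (E.isRep_rep F).1.fderiv), fun _ => rfl⟩
  have : E.vfFun a F = ((∑ i : E.vars F, a i * ⟨_, hpd i⟩ : E.funRing) : E.domain → 𝕜) := by
    funext p
    simp only [vfFun, AddSubmonoidClass.coe_finsetSum, Finset.sum_apply, MulMemClass.coe_mul,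
      Pi.mul_apply]
    conv_lhs => rw [pi_eq_sum_univ' (fun i : E.vars F => (a i).1 p)]
    rw [map_sum]
    refine Finset.sum_congr rfl fun i _ => ?_
    rw [map_smul, smul_eq_mul]
  rw [this]
  exact (∑ i : E.vars F, a i * ⟨_, hpd i⟩ : E.funRing).2

/-- The vector field `∑ i, a i ∂/∂i` (a formal, in general infinite, sum over all the dynamical
variables), as a derivation of the ring of functions. -/
noncomputable def vfRing (a : DynVar → E.funRing) : Derivation 𝕜 E.funRing E.funRing :=
  Derivation.mk'
    { toFun := fun F => ⟨E.vfFun a F, E.isLocal_vfFun a F⟩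
      map_add' := fun F G => by
        apply Subtype.ext
        funext p
        obtain ⟨s, γ, h⟩ := E.exists_common_rep ![F.1, G.1]
          (by intro i; fin_cases i; exacts [F.2, G.2])
        have hF : E.IsRep F.1 s (γ 0) := h 0
        have hG : E.IsRep G.1 s (γ 1) := h 1
        have hFG : E.IsRep (F + G).1 s (γ 0 + γ 1) :=
          ⟨hF.1.add hG.1, fun p => congrArg₂ (· + ·) (hF.2 p) (hG.2 p)⟩
        have hm : s.restrict p.1 ∈ s.restrict '' E.domain := ⟨p.1, p.2, rfl⟩
        change E.vfFun a (F + G) p = E.vfFun a F p + E.vfFun a G p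
        rw [E.vfFun_eq a _ hFG, E.vfFun_eq a _ hF, E.vfFun_eq a _ hG,
          fderiv_add (hF.1 _ hm).differentiableAt (hG.1 _ hm).differentiableAt]
        rfl
      map_smul' := fun c F => by
        apply Subtype.ext
        funext p
        have hF := E.isRep_rep F
        have hc : E.IsRep (c • F).1 (E.vars F) (c • E.rep F) :=
          ⟨hF.1.const_smul, fun p => congrArg (c • ·) (hF.2 p)⟩
        have hm : (E.vars F).restrict p.1 ∈ (E.vars F).restrict '' E.domain := ⟨p.1, p.2, rfl⟩
        change E.vfFun a (c • F) p = c • E.vfFun a F p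
        rw [E.vfFun_eq a _ hc, E.vfFun_eq a _ hF, fderiv_const_smul (hF.1 _ hm).differentiableAt]
        rfl }
    (fun F G => by
      apply Subtype.ext
      funext p
      obtain ⟨s, γ, h⟩ := E.exists_common_rep ![F.1, G.1]
        (by intro i; fin_cases i; exacts [F.2, G.2])
      have hF : E.IsRep F.1 s (γ 0) := h 0
      have hG : E.IsRep G.1 s (γ 1) := h 1
      have hFG : E.IsRep (F * G).1 s (γ 0 * γ 1) :=
        ⟨hF.1.mul hG.1, fun p => congrArg₂ (· * ·) (hF.2 p) (hG.2 p)⟩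
      have hm : s.restrict p.1 ∈ s.restrict '' E.domain := ⟨p.1, p.2, rfl⟩
      change E.vfFun a (F * G) p = F.1 p * E.vfFun a G p + G.1 p * E.vfFun a F p
      rw [E.vfFun_eq a _ hFG, E.vfFun_eq a _ hF, E.vfFun_eq a _ hG,
        fderiv_mul (hF.1 _ hm).differentiableAt (hG.1 _ hm).differentiableAt, hF.2 p, hG.2 p]
      rfl)

/-- Vector fields, as derivations of the field of functions. -/
abbrev VectorField : Type _ := Derivation 𝕜 E.FunField E.FunField

/-- The vector field `∑ i, a i ∂/∂i` on the field of functions. -/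
noncomputable def vf (a : DynVar → E.funRing) : E.VectorField := (E.vfRing a).toFrac E.FunField

/-- The partial derivative `∂/∂i`. -/
noncomputable def pd (i : DynVar) : E.VectorField := E.vf (Pi.single i 1)

/-- The vector field `X = ∂/∂t_x`. -/
noncomputable def X : E.VectorField := E.pd .tx

/-- The total derivative with respect to `x` restricted to functions of `x, t_x, t_k`:
`K = ∂/∂x + ∑_k (D^k t_x) ∂/∂t_k = ∂/∂x + t_x ∂/∂t + f ∂/∂t_1 + g ∂/∂t_{-1} + (D f) ∂/∂t_2 + ⋯`. -/
noncomputable def K : E.VectorField :=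
  E.vf fun i => match i with
    | .x => 1
    | .tx => 0
    | .t k => (E.shiftRing ^ k) (E.coordFun .tx)

noncomputable def C₁ : E.VectorField := ⁅E.X, E.K⁆
noncomputable def C₂ : E.VectorField := ⁅E.X, E.C₁⁆
noncomputable def Z₁ : E.VectorField := ⁅E.K, E.C₁⁆

/-- The characteristic `x`-ring `L_x`: the smallest set of vector fields which contains `X` and `K`
and is closed under linear combinations over the field of functions and under commutators. -/
noncomputable def charRing : Submodule E.FunField E.VectorField :=
  sInf {L | E.X ∈ L ∧ E.K ∈ L ∧ ∀ V ∈ L, ∀ W ∈ L, ⁅V, W⁆ ∈ L}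

/-! ### The functions in the criterion -/

/-- The function `t_x`. -/
noncomputable def tx : E.FunField := algebraMap E.funRing E.FunField (E.coordFun .tx)

/-- The right-hand side `f(x, t, t_1, t_x)` as a function. -/
noncomputable def rhs : E.FunField := algebraMap E.funRing E.FunField ⟨_, E.isLocal_f⟩

noncomputable def f_x : E.FunField := E.pd .x E.rhs
noncomputable def f_t : E.FunField := E.pd (.t 0) E.rhs
noncomputable def f_t₁ : E.FunField := E.pd (.t 1) E.rhs
noncomputable def f_tx : E.FunField := E.pd .tx E.rhs
noncomputable def f_txtx : E.FunField := E.pd .tx E.f_tx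
noncomputable def f_txtxtx : E.FunField := E.pd .tx E.f_txtx

/-- `p = (f_x + t_x f_t + f f_{t_1}) / f_{t_x}` -/
noncomputable def p : E.FunField := (E.f_x + E.tx * E.f_t + E.rhs * E.f_t₁) / E.f_tx

/-- `v = f_t + f_{t_x} f_{t_1}` -/
noncomputable def v : E.FunField := E.f_t + E.f_tx * E.f_t₁

/-- `w = f_{x t_x} + t_x f_{t_x t} + f f_{t_x t_1}` -/
noncomputable def w : E.FunField :=
  E.pd .x E.f_tx + E.tx * E.pd (.t 0) E.f_tx + E.rhs * E.pd (.t 1) E.f_tx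

/-- `h = f_{t_x t_x t_x} f_{t_x} - 3 f_{t_x t_x}^2` -/
noncomputable def h : E.FunField := E.f_txtxtx * E.f_tx - 3 * E.f_txtx ^ 2

/-- The coefficients of a linear difference system
`E₁₁ u + E₁₂ (D u) = F₁`, `E₂₂ (D u) + E₂₃ v + E₂₄ (D v) = F₂`, `E₃₂ (D u) + E₃₄ (D v) = F₃`
for two unknown functions `u`, `v`. -/
structure DiffSystem where
  E₁₁ : E.FunField
  E₁₂ : E.FunField
  E₂₂ : E.FunField
  E₂₃ : E.FunField
  E₂₄ : E.FunField
  E₃₂ : E.FunField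
  E₃₄ : E.FunField
  F₁ : E.FunField
  F₂ : E.FunField
  F₃ : E.FunField

namespace DiffSystem

variable {E} (S : E.DiffSystem)

/-- The determinant-type expression of the system. -/
noncomputable def delta : E.FunField :=
  -S.E₁₁ * S.E₂₂ * S.E₃₄ * E.D.symm S.E₃₄ + S.E₁₁ * S.E₂₄ * S.E₃₂ * E.D.symm S.E₃₄
    - S.E₁₂ * S.E₂₃ * S.E₃₄ * E.D.symm S.E₃₂

/-- The function `H` (the candidate for `u`). -/
noncomputable def H : E.FunField :=
  ((S.F₁ * S.E₂₄ * S.E₃₂ - S.F₁ * S.E₂₂ * S.E₃₄ + S.F₂ * S.E₁₂ * S.E₃₄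
      - S.F₃ * S.E₁₂ * S.E₂₄) * E.D.symm S.E₃₄
    - E.D.symm S.F₃ * S.E₁₂ * S.E₂₃ * S.E₃₄) / S.delta

/-- The candidate for `v`, obtained from `u = H` and the shifted third equation
`(D⁻¹ E₃₂) u + (D⁻¹ E₃₄) v = D⁻¹ F₃`. -/
noncomputable def V : E.FunField :=
  (E.D.symm S.F₃ - E.D.symm S.E₃₂ * S.H) / E.D.symm S.E₃₄

/-- The two conditions on a system: the determinant-type expression is nonzero, and `H` is
compatible with the shift. -/
def Condition : Prop :=
  S.delta ≠ 0 ∧ E.D S.H = S.F₁ / S.E₁₂ - S.E₁₁ / S.E₁₂ * S.H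

end DiffSystem

/-- The system for `u = β`, `v = α` in `[X, C₂] = α C₂ + β Z₁`. -/
noncomputable def system₁ : E.DiffSystem where
  E₁₁ := 1 / E.f_tx ^ 2
  E₁₂ := -1
  F₁ := 0
  E₂₂ := E.p
  E₂₃ := 1 / E.f_tx ^ 2
  E₂₄ := -(1 / E.f_tx)
  F₂ := 3 * E.f_txtx / E.f_tx ^ 3
  E₃₂ := E.w - E.v - E.p * E.f_txtx
  E₃₄ := E.f_txtx / E.f_tx
  F₃ := E.h / E.f_tx ^ 3

noncomputable def α : E.FunField := E.system₁.V
noncomputable def β : E.FunField := E.system₁.H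

/-- The system for `u = μ`, `v = γ` in `[K, C₂] = γ C₂ + μ Z₁`. -/
noncomputable def system₂ : E.DiffSystem where
  E₁₁ := 1 / E.f_tx
  E₁₂ := -1
  F₁ := E.f_txtx / E.f_tx ^ 2 + E.p * E.β / E.f_tx
  E₂₂ := E.p
  E₂₃ := 1 / E.f_tx
  E₂₄ := -(1 / E.f_tx)
  F₂ := (2 * E.w - E.p * (3 * E.f_txtx - E.f_tx * E.α)) / E.f_tx ^ 2
  E₃₂ := E.w - E.v - E.f_txtx * E.p
  E₃₄ := E.f_txtx / E.f_tx
  F₃ := (-3 * E.f_txtx * E.w + E.f_t * E.f_txtx - E.p * E.h) / E.f_tx ^ 2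
    + (E.pd .x E.f_txtx + E.tx * E.pd (.t 0) E.f_txtx + E.rhs * E.pd (.t 1) E.f_txtx) / E.f_tx

noncomputable def γ : E.FunField := E.system₂.V
noncomputable def μ : E.FunField := E.system₂.H

/-- The system for `u = σ`, `v = η` in `[K, Z₁] = η C₂ + σ Z₁`. -/
noncomputable def system₃ : E.DiffSystem where
  E₁₁ := 1
  E₁₂ := -1
  F₁ := E.p * (2 * E.μ - E.p * E.β - 2 * E.f_txtx / E.f_tx) + (2 * E.w - E.v) / E.f_tx
  E₂₂ := E.p
  E₂₃ := 1
  E₂₄ := -(1 / E.f_tx)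
  F₂ := E.p * (2 * E.γ - E.p * E.α) + E.K E.p
    + (3 * E.p ^ 2 * E.f_txtx - 3 * E.p * E.w) / E.f_tx
  E₃₂ := -E.f_txtx * E.p - E.v + E.w
  E₃₄ := E.f_txtx / E.f_tx
  F₃ := -(E.K - E.p • E.X) (E.f_txtx * E.p + E.v - E.w)
    + (E.f_txtx * E.p + E.v - E.w) * (2 * E.w - E.f_t - 2 * E.p * E.f_txtx) / E.f_tx

end SemiDiscreteEquation

/-! Conjugation by the shift, `V ↦ D V D⁻¹`, respects sums and brackets and is semilinear over `D`.
It sends `X` to `f_tx⁻¹ X` and `K` to `K - p X`; brackets of these two give the conjugates of `C₁`,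
`C₂`, `Z₁` as explicit combinations of `X, C₁, C₂, Z₁` (`isConj_C₁`, `isConj_C₂`, `isConj_Z₁`).

All fields involved are formal sums over the dynamical variables, hence determined by their values
on the variables. This gives a rigidity principle (`eq_zero_of_isConj`): if `W` kills `x`, `t_x`,
`t` and its conjugate is `c W + e X` with `c ≠ 0`, then `W = 0`, since the value at one `t_k`
determines the values at its neighbours.

By the Jacobi identity `[X, Z₁] = [K, C₂]`, so closure of the span of the five fields under brackets
depends on the three brackets `B = [X, C₂], [K, C₂], [K, Z₁]`. Each kills `x`, `t_x`, `t`, so it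
lies in the span only if `B = y C₂ + u Z₁`. Conjugating `B - y C₂ - u Z₁` and collecting the
coefficients of `Z₁`, `C₂`, `C₁` gives the three equations of a difference system. By rigidity a
solution yields the relation; by linear independence the relation yields a solution
(`DiffSystem.Governs`).

Each system is solved by elimination: `Du`, `Dy` and, by the shifted third equation, `y` are
removed, leaving `Δ u` equal to an explicit numerator. The three `Δ` are nonzero multiples of one
expression `minor`, whose nonvanishing is equivalent to linear independence of the five fields
(`linearIndependent_of_minor_ne_zero`, `minor_ne_zero`). -/

namespace SemiDiscreteEquation

/-! ### Partial derivatives of analytic functions of finitely many variables -/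

variable {𝕜 : Type*} [RCLike 𝕜] (E : SemiDiscreteEquation 𝕜)

/-- The partial derivative `∂/∂i` on the ring of functions. -/
noncomputable abbrev pdRing (i : DynVar) : Derivation 𝕜 E.funRing E.funRing :=
  E.vfRing (Pi.single i 1)

/-- `F` is an analytic function of the variables in `s`. -/
def DependsOn (F : E.funRing) (s : Finset DynVar) : Prop :=
  ∃ φ, E.IsRep F.1 s φ

variable {E}

theorem coe_vfRing (a : DynVar → E.funRing) {F : E.funRing} {s : Finset DynVar}
    {φ : (s → 𝕜) → 𝕜} (h : E.IsRep F.1 s φ) (p : E.domain) :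
    (E.vfRing a F).1 p = fderiv 𝕜 φ (s.restrict p.1) (fun i => (a i).1 p) :=
  E.vfFun_eq a F h p

theorem coe_single_one (i j : DynVar) (p : E.domain) :
    ((Pi.single i 1 : DynVar → E.funRing) j).1 p = (Pi.single i 1 : DynVar → 𝕜) j := by
  by_cases h : j = i
  · subst h; simp
  · simp [h]

theorem coe_pdRing (i : DynVar) {F : E.funRing} {s : Finset DynVar}
    {φ : (s → 𝕜) → 𝕜} (h : E.IsRep F.1 s φ) (p : E.domain) :
    (E.pdRing i F).1 p =
      fderiv 𝕜 φ (s.restrict p.1) (fun j => (Pi.single i 1 : DynVar → 𝕜) j) := by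
  rw [coe_vfRing _ h]
  simp only [coe_single_one]

theorem isRep_pdRing (i : DynVar) {F : E.funRing} {s : Finset DynVar}
    {φ : (s → 𝕜) → 𝕜} (h : E.IsRep F.1 s φ) :
    E.IsRep (E.pdRing i F).1 s
      (fun q => fderiv 𝕜 φ q (fun j => (Pi.single i 1 : DynVar → 𝕜) j)) :=
  ⟨(ContinuousLinearMap.apply 𝕜 𝕜
      (fun j => (Pi.single i 1 : DynVar → 𝕜) j : s → 𝕜)).comp_analyticOnNhd h.1.fderiv,
    coe_pdRing i h⟩

theorem DependsOn.pdRing {F : E.funRing} {s : Finset DynVar} (h : E.DependsOn F s)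
    (i : DynVar) : E.DependsOn (E.pdRing i F) s :=
  ⟨_, isRep_pdRing i h.choose_spec⟩

theorem clm_apply_eq_sum_single {s : Finset DynVar} (L : (s → 𝕜) →L[𝕜] 𝕜) (b : s → 𝕜) :
    L b = ∑ i : s, b i * L (fun j => (Pi.single i.1 1 : DynVar → 𝕜) j) := by
  conv_lhs => rw [pi_eq_sum_univ' b, map_sum]
  refine Finset.sum_congr rfl fun i _ => ?_
  rw [map_smul, smul_eq_mul]
  congr 2
  funext j
  by_cases hij : i = j
  · subst hij; simp
  · simp [hij, Subtype.coe_ne_coe.2 (Ne.symm hij)]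

/-- On a function of finitely many variables the formal infinite sum has only finitely many nonzero
terms. -/
theorem vfRing_eq_sum (a : DynVar → E.funRing) {F : E.funRing} {s : Finset DynVar}
    (h : E.DependsOn F s) : E.vfRing a F = ∑ i ∈ s, a i * E.pdRing i F := by
  obtain ⟨φ, h⟩ := h
  apply Subtype.ext
  funext p
  simp only [AddSubmonoidClass.coe_finsetSum, Finset.sum_apply, MulMemClass.coe_mul,
    Pi.mul_apply]
  rw [coe_vfRing _ h, clm_apply_eq_sum_single, ← Finset.sum_coe_sort s]
  exact Finset.sum_congr rfl fun i _ => by rw [coe_pdRing _ h]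

theorem pdRing_comm (i j : DynVar) (F : E.funRing) :
    E.pdRing i (E.pdRing j F) = E.pdRing j (E.pdRing i F) := by
  have h := E.isRep_rep F
  apply Subtype.ext
  funext p
  rw [coe_pdRing i (isRep_pdRing j h), coe_pdRing j (isRep_pdRing i h)]
  have ha : AnalyticAt 𝕜 (E.rep F) ((E.vars F).restrict p.1) := h.1 _ ⟨p.1, p.2, rfl⟩
  have hd := ha.fderiv.differentiableAt
  rw [fderiv_clm_apply hd (by fun_prop), fderiv_clm_apply hd (by fun_prop)]
  -- Smoothness `⊤` means analyticity here, which is enough for the second derivative to be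
  -- symmetric.
  simpa using (ha.contDiffAt (n := ⊤)).isSymmSndFDerivAt (by simp) _ _

/-- Chain rule: `D F` is `F` composed with the shift map, whose components are the functions `D i`
for the variables `i`. -/
theorem vfRing_shiftRing (a : DynVar → E.funRing) {F : E.funRing} {s : Finset DynVar}
    (h : E.DependsOn F s) : E.vfRing a (E.shiftRing F) =
      ∑ i ∈ s, E.vfRing a (E.shiftRing (E.coordFun i)) * E.shiftRing (E.pdRing i F) := by
  obtain ⟨φ, h⟩ := h
  obtain ⟨s', γ, hγ⟩ := E.exists_common_rep (fun i : s => (E.shiftRing (E.coordFun i)).1)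
    (fun i => (E.shiftRing (E.coordFun i)).2)
  have hmem (p : E.domain) : (fun i => γ i (s'.restrict p.1)) = s.restrict (E.shiftPt p).1 :=
    funext fun i => ((hγ i).2 p).symm
  have hrep : E.IsRep (E.shiftRing F).1 s' (fun q => φ (fun i => γ i q)) := by
    refine ⟨h.1.comp (AnalyticOnNhd.pi (𝕜 := 𝕜) fun i => (hγ i).1) ?_, fun p => ?_⟩
    · rintro _ ⟨p, hp, rfl⟩
      exact ⟨_, (E.shiftPt ⟨p, hp⟩).2, (hmem ⟨p, hp⟩).symm⟩
    · change F.1 (E.shiftPt p) = φ (fun i => γ i (s'.restrict p.1))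
      rw [h.2, hmem]
  apply Subtype.ext
  funext p
  simp only [AddSubmonoidClass.coe_finsetSum, Finset.sum_apply, MulMemClass.coe_mul,
    Pi.mul_apply]
  have hdγ (i) : DifferentiableAt 𝕜 (γ i) (s'.restrict p.1) :=
    ((hγ i).1 _ ⟨p.1, p.2, rfl⟩).differentiableAt
  have hdφ : DifferentiableAt 𝕜 φ (fun i => γ i (s'.restrict p.1)) := by
    rw [hmem]
    exact (h.1 _ ⟨_, (E.shiftPt p).2, rfl⟩).differentiableAt
  have hchain := fderiv_fun_comp (𝕜 := 𝕜) (f := fun q i => γ i q) (s'.restrict p.1) hdφ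
    (differentiableAt_pi.2 hdγ)
  rw [coe_vfRing _ hrep, hchain, ContinuousLinearMap.comp_apply, hmem, clm_apply_eq_sum_single,
    ← Finset.sum_coe_sort s]
  refine Finset.sum_congr rfl fun i _ => ?_
  rw [coe_vfRing _ (hγ i), fderiv_pi hdγ]
  change _ = _ * (E.pdRing i F).1 (E.shiftPt p)
  rw [coe_pdRing _ h]
  rfl

variable (E)

/-! ### Vector fields acting through the partial derivatives -/

/-- The inclusion of the ring of functions in the field of functions. -/
noncomputable abbrev toField : E.funRing →+* E.FunField := algebraMap E.funRing E.FunField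

/-- The dynamical variable `i` as an element of the field of functions. -/
noncomputable def coord (i : DynVar) : E.FunField := E.toField (E.coordFun i)

theorem D_toField (F : E.funRing) : E.D (E.toField F) = E.toField (E.shiftRing F) :=
  IsFractionRing.ringEquivOfRingEquiv_algebraMap _ _

theorem vf_toField (a : DynVar → E.funRing) (F : E.funRing) :
    E.vf a (E.toField F) = E.toField (E.vfRing a F) :=
  Derivation.toFrac_algebraMap _ _ _

/-- The vector fields which are formal sums `∑ i, (V i) ∂/∂i` over the dynamical variables. -/
noncomputable def geometric : Submodule E.FunField E.VectorField where
  carrier := {V | ∀ F s, E.DependsOn F s →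
    V (E.toField F) = ∑ i ∈ s, V (E.coord i) * E.toField (E.pdRing i F)}
  zero_mem' F s _ := by simp
  add_mem' {V W} hV hW F s h := by
    simp only [Derivation.add_apply, hV F s h, hW F s h, add_mul, Finset.sum_add_distrib]
  smul_mem' c V hV F s h := by
    simp only [Derivation.smul_apply, hV F s h, smul_eq_mul, Finset.mul_sum, mul_assoc]

variable {E}

theorem vfRing_coordFun (a : DynVar → E.funRing) (i : DynVar) :
    E.vfRing a (E.coordFun i) = a i := by
  apply Subtype.ext
  funext p
  have h : E.IsRep (E.coordFun i).1 {i} (fun q => q ⟨i, Finset.mem_singleton_self i⟩) :=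
    ⟨(ContinuousLinearMap.proj (R := 𝕜) (φ := fun _ : ({i} : Finset DynVar) => 𝕜)
      ⟨i, Finset.mem_singleton_self i⟩).analyticOnNhd _, fun _ => rfl⟩
  rw [coe_vfRing a h]
  exact DFunLike.congr_fun (ContinuousLinearMap.proj (R := 𝕜)
    (φ := fun _ : ({i} : Finset DynVar) => 𝕜) ⟨i, Finset.mem_singleton_self i⟩).fderiv
    (fun j : ({i} : Finset DynVar) => (a j).1 p)

theorem vf_coord (a : DynVar → E.funRing) (i : DynVar) :
    E.vf a (E.coord i) = E.toField (a i) := by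
  rw [coord, vf_toField, vfRing_coordFun]

theorem vf_mem_geometric (a : DynVar → E.funRing) : E.vf a ∈ E.geometric := by
  intro F s h
  simp only [vf_coord, vf_toField, vfRing_eq_sum a h, map_sum, map_mul]

theorem X_mem_geometric : E.X ∈ E.geometric := vf_mem_geometric _

theorem K_mem_geometric : E.K ∈ E.geometric := vf_mem_geometric _

/-- The second-order terms of `V W` and `W V` coincide because mixed partial derivatives commute, so
a first-order expression remains. -/
theorem lie_mem_geometric {V W : E.VectorField} (hV : V ∈ E.geometric) (hW : W ∈ E.geometric) :
    ⁅V, W⁆ ∈ E.geometric := by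
  intro F s h
  have expand {V W : E.VectorField} (hV : V ∈ E.geometric) (hW : W ∈ E.geometric) :
      V (W (E.toField F)) = (∑ i ∈ s, V (W (E.coord i)) * E.toField (E.pdRing i F)) +
        ∑ i ∈ s, ∑ j ∈ s, W (E.coord i) * V (E.coord j) *
          E.toField (E.pdRing j (E.pdRing i F)) := by
    rw [hW F s h, map_sum, ← Finset.sum_add_distrib]
    refine Finset.sum_congr rfl fun i _ => ?_
    rw [Derivation.leibniz, hV _ s (h.pdRing i), smul_eq_mul, smul_eq_mul, Finset.mul_sum,
      add_comm, mul_comm]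
    simp only [mul_assoc]
  have symm : ∑ i ∈ s, ∑ j ∈ s, W (E.coord i) * V (E.coord j) *
        E.toField (E.pdRing j (E.pdRing i F)) =
      ∑ i ∈ s, ∑ j ∈ s, V (E.coord i) * W (E.coord j) *
        E.toField (E.pdRing j (E.pdRing i F)) := by
    rw [Finset.sum_comm]
    refine Finset.sum_congr rfl fun i _ => Finset.sum_congr rfl fun j _ => ?_
    rw [pdRing_comm, mul_comm (W _)]
  simp only [Derivation.commutator_apply, expand hV hW, expand hW hV, symm, sub_mul,
    Finset.sum_sub_distrib]
  ring

theorem derivation_ext {V W : E.VectorField}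
    (h : ∀ F, V (E.toField F) = W (E.toField F)) : V = W := by
  ext z
  obtain ⟨a, b, hb, rfl⟩ := IsFractionRing.div_surjective (A := E.funRing) z
  rw [Derivation.leibniz_div, Derivation.leibniz_div]
  simp only [h]

/-- This is what membership in `geometric` provides: an arbitrary derivation of the field may kill
every dynamical variable and still be nonzero on a transcendental function of them. -/
theorem eq_zero_of_mem_geometric {V : E.VectorField} (hV : V ∈ E.geometric)
    (h : ∀ i, V (E.coord i) = 0) : V = 0 :=
  derivation_ext fun F => by simp [hV F _ ⟨_, E.isRep_rep F⟩, h]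

/-! ### Conjugation by the shift -/

/-- `V'` is the conjugate `D V D⁻¹` of `V`. -/
def IsConj (V V' : E.VectorField) : Prop := ∀ z, V' (E.D z) = E.D (V z)

namespace IsConj

variable {V V' W W' : E.VectorField}

theorem congr_right (h : IsConj V V') (e : V' = W') : IsConj V W' := e ▸ h

theorem add (hV : IsConj V V') (hW : IsConj W W') : IsConj (V + W) (V' + W') := fun z => by
  simp [hV z, hW z]

theorem sub (hV : IsConj V V') (hW : IsConj W W') : IsConj (V - W) (V' - W') := fun z => by
  simp [hV z, hW z]

theorem smul (a : E.FunField) (hV : IsConj V V') : IsConj (a • V) (E.D a • V') := fun z => by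
  simp [hV z]

theorem lie (hV : IsConj V V') (hW : IsConj W W') : IsConj ⁅V, W⁆ ⁅V', W'⁆ := fun z => by
  simp [Derivation.commutator_apply, hV _, hW _]

theorem eq_zero (h : IsConj 0 V') : V' = 0 := by
  ext z
  simpa using h (E.D.symm z)

/-- By the chain rule both sides are determined by the values on the dynamical variables, and the
quotient rule extends the identity to the field. -/
theorem of_geometric (hV : V ∈ E.geometric) (hV' : V' ∈ E.geometric)
    (h : ∀ i, V' (E.D (E.coord i)) = E.D (V (E.coord i))) : IsConj V V' := by
  intro z
  have key (F : E.funRing) : V' (E.D (E.toField F)) = E.D (V (E.toField F)) := by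
    have hF : E.DependsOn F (E.vars F) := ⟨_, E.isRep_rep F⟩
    rw [hV F _ hF, D_toField, hV' _ _ ⟨_, E.isRep_rep _⟩]
    -- One finite set of variables serves `D F` (index `none`) and all the `D i`, so that every
    -- expansion of `V'` below runs over the same index set.
    obtain ⟨s', γ, hγ⟩ := E.exists_common_rep
      (fun i : Option (E.vars F) => i.elim (E.shiftRing F).1
        fun i => (E.shiftRing (E.coordFun i)).1)
      (by rintro (_ | i); exacts [(E.shiftRing F).2, (E.shiftRing (E.coordFun i)).2])
    rw [← hV' _ _ ⟨_, E.isRep_rep _⟩, hV' _ s' ⟨_, hγ none⟩, map_sum]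
    simp only [pdRing, vfRing_shiftRing _ hF, map_sum, Finset.mul_sum]
    rw [Finset.sum_comm]
    refine Finset.sum_congr rfl fun i hi => ?_
    rw [map_mul, ← h i, coord, D_toField, D_toField, hV' _ s' ⟨_, hγ (some ⟨i, hi⟩)⟩,
      Finset.sum_mul]
    exact Finset.sum_congr rfl fun j _ => by rw [map_mul, mul_assoc]
  obtain ⟨a, b, hb, rfl⟩ := IsFractionRing.div_surjective (A := E.funRing) z
  rw [map_div₀, Derivation.leibniz_div, Derivation.leibniz_div]
  simp only [key, map_inv₀, map_mul, map_sub, map_pow, smul_eq_mul]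

end IsConj

/-! ### Values on the dynamical variables and on the right-hand side -/

@[simp] theorem X_x : E.X (E.coord .x) = 0 := by
  rw [X, pd, vf_coord, Pi.single_eq_of_ne (by simp), map_zero]

@[simp] theorem X_tx : E.X (E.coord .tx) = 1 := by
  rw [X, pd, vf_coord, Pi.single_eq_same, map_one]

@[simp] theorem X_t (k : ℤ) : E.X (E.coord (.t k)) = 0 := by
  rw [X, pd, vf_coord, Pi.single_eq_of_ne (by simp), map_zero]

@[simp] theorem K_x : E.K (E.coord .x) = 1 := by
  rw [K, vf_coord, map_one]

@[simp] theorem K_tx : E.K (E.coord .tx) = 0 := by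
  rw [K, vf_coord, map_zero]

theorem K_t (k : ℤ) :
    E.K (E.coord (.t k)) = E.toField ((E.shiftRing ^ k) (E.coordFun .tx)) := by
  rw [K, vf_coord]

@[simp] theorem D_x : E.D (E.coord .x) = E.coord .x := by
  rw [coord, D_toField]; rfl

@[simp] theorem D_tx : E.D (E.coord .tx) = E.rhs := by
  rw [coord, D_toField]; rfl

@[simp] theorem D_t (k : ℤ) : E.D (E.coord (.t k)) = E.coord (.t (k + 1)) := by
  rw [coord, D_toField]; rfl

theorem K_t_add_one (k : ℤ) : E.K (E.coord (.t (k + 1))) = E.D (E.K (E.coord (.t k))) := by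
  rw [K_t, K_t, D_toField, add_comm, zpow_one_add]; rfl

@[simp] theorem K_t_zero : E.K (E.coord (.t 0)) = E.coord .tx := by
  rw [K_t, zpow_zero]; rfl

@[simp] theorem K_t_one : E.K (E.coord (.t 1)) = E.rhs := by
  rw [← zero_add (1 : ℤ), K_t_add_one, K_t_zero, D_tx]

/-- The variables of the right-hand side. -/
def rhsVars : Finset DynVar := {.x, .tx, .t 0, .t 1}

theorem dependsOn_rhs : E.DependsOn ⟨_, E.isLocal_f⟩ rhsVars := by
  let ι : Fin 4 → (rhsVars : Finset DynVar) :=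
    ![⟨.x, by decide⟩, ⟨.t 0, by decide⟩, ⟨.t 1, by decide⟩, ⟨.tx, by decide⟩]
  have hι (p : DynVar → 𝕜) : (fun j => (rhsVars.restrict p) (ι j)) =
      ![p .x, p (.t 0), p (.t 1), p .tx] := by
    funext j
    fin_cases j <;> rfl
  refine ⟨fun q => E.f (fun j => q (ι j)), ?_, fun p => congrArg E.f (hι p).symm⟩
  refine E.analytic_f.comp (AnalyticOnNhd.pi (𝕜 := 𝕜) fun j =>
    (ContinuousLinearMap.proj (R := 𝕜) (φ := fun _ : rhsVars => 𝕜) (ι j)).analyticOnNhd _) ?_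
  rintro _ ⟨p, hp, rfl⟩
  exact ⟨p, hp, (hι p).symm⟩

theorem pd_toField (i : DynVar) (F : E.funRing) :
    E.pd i (E.toField F) = E.toField (E.pdRing i F) :=
  vf_toField ..

theorem apply_of_dependsOn_rhsVars {V : E.VectorField} (hV : V ∈ E.geometric) {F : E.funRing}
    (hF : E.DependsOn F rhsVars) : V (E.toField F) =
      V (E.coord .x) * E.pd .x (E.toField F) + V (E.coord .tx) * E.pd .tx (E.toField F) +
        V (E.coord (.t 0)) * E.pd (.t 0) (E.toField F) +
        V (E.coord (.t 1)) * E.pd (.t 1) (E.toField F) := by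
  rw [hV F _ hF, rhsVars]
  simp [pd_toField, add_assoc]

theorem f_tx_eq : E.f_tx = E.toField (E.pdRing .tx ⟨_, E.isLocal_f⟩) := pd_toField ..

theorem f_txtx_eq : E.f_txtx = E.toField (E.pdRing .tx (E.pdRing .tx ⟨_, E.isLocal_f⟩)) := by
  rw [f_txtx, f_tx_eq, pd_toField]

theorem apply_rhs {V : E.VectorField} (hV : V ∈ E.geometric) : V E.rhs =
    V (E.coord .x) * E.f_x + V (E.coord .tx) * E.f_tx + V (E.coord (.t 0)) * E.f_t +
      V (E.coord (.t 1)) * E.f_t₁ :=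
  apply_of_dependsOn_rhsVars hV dependsOn_rhs

@[simp] theorem X_rhs : E.X E.rhs = E.f_tx := rfl

@[simp] theorem X_f_tx : E.X E.f_tx = E.f_txtx := rfl

@[simp] theorem X_f_txtx : E.X E.f_txtx = E.f_txtxtx := rfl

theorem K_rhs_eq : E.K E.rhs = E.f_x + E.tx * E.f_t + E.rhs * E.f_t₁ := by
  rw [apply_rhs K_mem_geometric]
  simp [show E.tx = E.coord .tx from rfl]

@[simp] theorem K_f_tx : E.K E.f_tx = E.w := by
  rw [f_tx_eq, apply_of_dependsOn_rhsVars K_mem_geometric (dependsOn_rhs.pdRing _), ← f_tx_eq]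
  simp [w, show E.tx = E.coord .tx from rfl]

theorem K_f_txtx : E.K E.f_txtx =
    E.pd .x E.f_txtx + E.tx * E.pd (.t 0) E.f_txtx + E.rhs * E.pd (.t 1) E.f_txtx := by
  rw [f_txtx_eq, apply_of_dependsOn_rhsVars K_mem_geometric ((dependsOn_rhs.pdRing _).pdRing _),
    ← f_txtx_eq]
  simp [show E.tx = E.coord .tx from rfl]

theorem f_tx_ne_zero (hf : E.f_txtx ≠ 0) : E.f_tx ≠ 0 := fun h => hf (by
  rw [← X_f_tx, h, map_zero])

theorem K_rhs (hu : E.f_tx ≠ 0) : E.K E.rhs = E.p * E.f_tx := by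
  rw [K_rhs_eq, p, div_mul_cancel₀ _ hu]

/-! ### The vector fields `C₁`, `C₂`, `Z₁` -/

theorem C₁_mem_geometric : E.C₁ ∈ E.geometric := lie_mem_geometric X_mem_geometric K_mem_geometric

theorem C₂_mem_geometric : E.C₂ ∈ E.geometric := lie_mem_geometric X_mem_geometric C₁_mem_geometric

theorem Z₁_mem_geometric : E.Z₁ ∈ E.geometric := lie_mem_geometric K_mem_geometric C₁_mem_geometric

@[simp] theorem C₁_x : E.C₁ (E.coord .x) = 0 := by simp [C₁, Derivation.commutator_apply]

@[simp] theorem C₁_tx : E.C₁ (E.coord .tx) = 0 := by simp [C₁, Derivation.commutator_apply]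

@[simp] theorem C₁_t_zero : E.C₁ (E.coord (.t 0)) = 1 := by
  simp [C₁, Derivation.commutator_apply]

@[simp] theorem C₁_t_one : E.C₁ (E.coord (.t 1)) = E.f_tx := by
  simp [C₁, Derivation.commutator_apply]

@[simp] theorem C₁_rhs : E.C₁ E.rhs = E.v := by
  rw [apply_rhs C₁_mem_geometric]
  simp [v]

@[simp] theorem C₂_x : E.C₂ (E.coord .x) = 0 := by simp [C₂, Derivation.commutator_apply]

@[simp] theorem C₂_tx : E.C₂ (E.coord .tx) = 0 := by simp [C₂, Derivation.commutator_apply]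

@[simp] theorem C₂_t_zero : E.C₂ (E.coord (.t 0)) = 0 := by
  simp [C₂, Derivation.commutator_apply]

@[simp] theorem C₂_t_one : E.C₂ (E.coord (.t 1)) = E.f_txtx := by
  simp [C₂, Derivation.commutator_apply]

@[simp] theorem C₂_rhs : E.C₂ E.rhs = E.f_txtx * E.f_t₁ := by
  rw [apply_rhs C₂_mem_geometric]
  simp

@[simp] theorem Z₁_x : E.Z₁ (E.coord .x) = 0 := by simp [Z₁, Derivation.commutator_apply]

@[simp] theorem Z₁_tx : E.Z₁ (E.coord .tx) = 0 := by simp [Z₁, Derivation.commutator_apply]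

@[simp] theorem Z₁_t_zero : E.Z₁ (E.coord (.t 0)) = 0 := by
  simp [Z₁, Derivation.commutator_apply]

@[simp] theorem Z₁_t_one : E.Z₁ (E.coord (.t 1)) = E.w - E.v := by
  simp [Z₁, Derivation.commutator_apply]

@[simp] theorem Z₁_rhs : E.Z₁ E.rhs = (E.w - E.v) * E.f_t₁ := by
  rw [apply_rhs Z₁_mem_geometric]
  simp

/-- This and the next two derivatives come from evaluating a bracket on `f` in two ways: as a vector
field with known coefficients, and as a commutator of operators. -/
theorem X_v : E.X E.v = E.C₁ E.f_tx + E.f_txtx * E.f_t₁ := by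
  have h : E.C₂ E.rhs = E.X (E.C₁ E.rhs) - E.C₁ (E.X E.rhs) := Derivation.commutator_apply ..
  rw [C₂_rhs, C₁_rhs, X_rhs] at h
  linear_combination -h

theorem X_p (hu : E.f_tx ≠ 0) : E.X E.p = (E.v + E.w - E.p * E.f_txtx) / E.f_tx := by
  have h : E.C₁ E.rhs = E.X (E.K E.rhs) - E.K (E.X E.rhs) := Derivation.commutator_apply ..
  rw [C₁_rhs, X_rhs, K_f_tx, K_rhs hu, Derivation.leibniz, X_f_tx, smul_eq_mul, smul_eq_mul] at h
  rw [eq_div_iff hu]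
  linear_combination -h

theorem C₁_p (hu : E.f_tx ≠ 0) : E.C₁ E.p =
    (E.K E.v - (E.w - E.v) * E.f_t₁ - E.p * E.C₁ E.f_tx) / E.f_tx := by
  have h : E.Z₁ E.rhs = E.K (E.C₁ E.rhs) - E.C₁ (E.K E.rhs) := Derivation.commutator_apply ..
  rw [C₁_rhs, Z₁_rhs, K_rhs hu, Derivation.leibniz, smul_eq_mul, smul_eq_mul] at h
  rw [eq_div_iff hu]
  linear_combination h

/-! ### The conjugates of the basic vector fields -/

theorem isConj_X (hu : E.f_tx ≠ 0) : IsConj E.X (E.f_tx⁻¹ • E.X) := by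
  refine .of_geometric X_mem_geometric (E.geometric.smul_mem _ X_mem_geometric) fun i => ?_
  cases i <;> simp [hu]

/-- On the `t_k` and on `x`, `K` already commutes with `D`. On `t_x` it does not: `K f = p f_tx`,
whereas `K t_x = 0`. Subtracting `p X` repairs exactly this. -/
theorem isConj_K (hu : E.f_tx ≠ 0) : IsConj E.K (E.K - E.p • E.X) := by
  refine .of_geometric K_mem_geometric
    (E.geometric.sub_mem K_mem_geometric (E.geometric.smul_mem _ X_mem_geometric)) fun i => ?_
  cases i with
  | t k => simp [K_t_add_one]
  | _ => simp [K_rhs hu]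

theorem smul_lie_eq (a : E.FunField) (V W : E.VectorField) :
    ⁅a • V, W⁆ = a • ⁅V, W⁆ - W a • V := by
  ext z
  simp only [Derivation.commutator_apply, Derivation.smul_apply, Derivation.sub_apply,
    Derivation.leibniz, smul_eq_mul]
  ring

theorem lie_smul_eq (a : E.FunField) (V W : E.VectorField) :
    ⁅V, a • W⁆ = a • ⁅V, W⁆ + V a • W := by
  ext z
  simp only [Derivation.commutator_apply, Derivation.smul_apply, Derivation.add_apply,
    Derivation.leibniz, smul_eq_mul]
  ring

theorem lie_X_K : ⁅E.X, E.K⁆ = E.C₁ := rfl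

theorem lie_X_C₁ : ⁅E.X, E.C₁⁆ = E.C₂ := rfl

theorem lie_K_C₁ : ⁅E.K, E.C₁⁆ = E.Z₁ := rfl

theorem lie_K_X : ⁅E.K, E.X⁆ = -E.C₁ := (lie_skew _ _).symm

/-- Jacobi identity, the remaining term being `[C₁, C₁] = 0`. It leaves three brackets to be
controlled. -/
theorem lie_X_Z₁ : ⁅E.X, E.Z₁⁆ = ⁅E.K, E.C₂⁆ := by
  rw [← lie_K_C₁, leibniz_lie, lie_X_K, lie_self, zero_add, lie_X_C₁]

theorem lie_inv_smul_X (W : E.VectorField) :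
    ⁅E.f_tx⁻¹ • E.X, W⁆ = E.f_tx⁻¹ • ⁅E.X, W⁆ + (E.f_tx⁻¹ ^ 2 * W E.f_tx) • E.X := by
  rw [smul_lie_eq, Derivation.leibniz_inv, smul_eq_mul, neg_mul, neg_smul, sub_neg_eq_add]

theorem lie_K_sub_smul_X (W : E.VectorField) :
    ⁅E.K - E.p • E.X, W⁆ = ⁅E.K, W⁆ - E.p • ⁅E.X, W⁆ + W E.p • E.X := by
  rw [sub_lie, smul_lie_eq, sub_sub_eq_add_sub, sub_add_eq_add_sub]

theorem apply_div_pow (V : E.VectorField) (a : E.FunField) {b : E.FunField} (hb : b ≠ 0) (n : ℕ) :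
    V (a / b ^ n) = V a / b ^ n - n * a * V b / b ^ (n + 1) := by
  rw [Derivation.leibniz_div, Derivation.leibniz_pow]
  cases n with
  | zero => simp
  | succ n =>
    simp only [nsmul_eq_mul, smul_eq_mul, Nat.add_sub_cancel]
    field_simp
    ring

/-- Used to eliminate `f_t`, so that the coefficient identities below involve `v` and `f_t₁` only.
-/
theorem f_t_eq : E.f_t = E.v - E.f_tx * E.f_t₁ := by rw [v]; ring

theorem isConj_C₁ (hu : E.f_tx ≠ 0) :
    IsConj E.C₁ (E.f_tx⁻¹ • E.C₁ + (-E.v / E.f_tx ^ 2) • E.X) := by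
  refine ((isConj_X hu).lie (isConj_K hu)).congr_right ?_
  rw [lie_inv_smul_X, lie_sub, lie_smul_eq, lie_X_K, lie_self, X_p hu, Derivation.sub_apply,
    Derivation.smul_apply, K_f_tx, X_f_tx, smul_eq_mul]
  match_scalars <;> field_simp
  ring

theorem isConj_C₂ (hu : E.f_tx ≠ 0) :
    IsConj E.C₂ ((1 / E.f_tx ^ 2) • E.C₂ + (-E.f_txtx / E.f_tx ^ 3) • E.C₁ +
      (E.f_txtx * E.f_t / E.f_tx ^ 4) • E.X) := by
  refine ((isConj_X hu).lie (isConj_C₁ hu)).congr_right ?_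
  simp only [lie_inv_smul_X, lie_add, lie_smul_eq, lie_X_C₁, lie_self,
    Derivation.smul_apply, X_f_tx, smul_eq_mul, apply_div_pow _ _ hu, Derivation.leibniz_inv,
    map_neg, X_v, f_t_eq]
  match_scalars <;> field_simp
  ring

theorem isConj_Z₁ (hu : E.f_tx ≠ 0) :
    IsConj E.Z₁ (E.f_tx⁻¹ • E.Z₁ + (-E.p / E.f_tx) • E.C₂ +
      (-(E.w - E.v - E.p * E.f_txtx) / E.f_tx ^ 2) • E.C₁ +
      ((E.w - E.v - E.p * E.f_txtx) * E.f_t / E.f_tx ^ 3) • E.X) := by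
  refine ((isConj_K hu).lie (isConj_C₁ hu)).congr_right ?_
  simp only [lie_K_sub_smul_X, lie_add, lie_smul_eq, lie_X_C₁, lie_K_C₁, lie_K_X, lie_self,
    Derivation.sub_apply, Derivation.smul_apply, X_f_tx, K_f_tx, smul_eq_mul,
    apply_div_pow _ _ hu, Derivation.leibniz_inv, map_neg, X_v, f_t_eq, X_p hu, C₁_p hu]
  match_scalars <;> field_simp <;> ring

/-! ### Uniqueness up to conjugation -/

/-- Since `X` kills every `t_k`, the conjugation relation reads `c W(t_{k+1}) = D(W(t_k))`. With `c
≠ 0` and `D` injective, vanishing at `t` spreads to all `t_k` in both directions. -/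
theorem eq_zero_of_isConj {W : E.VectorField} (hW : W ∈ E.geometric) (hx : W (E.coord .x) = 0)
    (htx : W (E.coord .tx) = 0) (ht : W (E.coord (.t 0)) = 0) {c e : E.FunField} (hc : c ≠ 0)
    (h : IsConj W (c • W + e • E.X)) : W = 0 := by
  have step (k : ℤ) : W (E.coord (.t (k + 1))) = 0 ↔ W (E.coord (.t k)) = 0 := by
    have hk := h (E.coord (.t k))
    simp only [D_t, Derivation.add_apply, Derivation.smul_apply, X_t, smul_eq_mul, mul_zero,
      add_zero] at hk
    rw [← map_eq_zero_iff E.D E.D.injective (x := W (E.coord (.t k))), ← hk, mul_eq_zero,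
      or_iff_right hc]
  refine eq_zero_of_mem_geometric hW fun i => ?_
  match i with
  | .x => exact hx
  | .tx => exact htx
  | .t k =>
    induction k using Int.induction_on with
    | zero => exact ht
    | succ n ih => exact (step _).2 ih
    | pred n ih => exact (step _).1 (by rwa [sub_add_cancel])

/-! ### Linear difference systems -/

namespace DiffSystem

variable (S : E.DiffSystem)

/-- `u` and `y` solve the system. -/
def Solves (u y : E.FunField) : Prop :=
  S.E₁₁ * u + S.E₁₂ * E.D u - S.F₁ = 0 ∧
  S.E₂₂ * E.D u + S.E₂₃ * y + S.E₂₄ * E.D y - S.F₂ = 0 ∧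
  S.E₃₂ * E.D u + S.E₃₄ * E.D y - S.F₃ = 0

variable {S}

/-- The condition on `D H` is the first equation and the definition of `V` is the shifted third one.
Modulo these, the second equation is `Δ H = numerator`, up to a nonzero factor. -/
theorem Condition.solves (h₁₂ : S.E₁₂ ≠ 0) (h₃₄ : S.E₃₄ ≠ 0) (h : S.Condition) :
    S.Solves S.H S.V := by
  have h₃₄' : E.D.symm S.E₃₄ ≠ 0 := by simpa using h₃₄
  obtain ⟨hΔ, hH⟩ := h
  have e₁ : S.E₁₁ * S.H + S.E₁₂ * E.D S.H - S.F₁ = 0 := by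
    rw [hH]; field_simp; ring
  have hDV : E.D S.V = (S.F₃ - S.E₃₂ * E.D S.H) / S.E₃₄ := by simp [V]
  have e₃ : S.E₃₂ * E.D S.H + S.E₃₄ * E.D S.V - S.F₃ = 0 := by
    rw [hDV]; field_simp; ring
  have hV : S.V * E.D.symm S.E₃₄ = E.D.symm S.F₃ - E.D.symm S.E₃₂ * S.H :=
    div_mul_cancel₀ _ h₃₄'
  have hHΔ : S.H * S.delta = _ := div_mul_cancel₀ _ hΔ
  refine ⟨e₁, ?_, e₃⟩
  have : S.E₁₂ * S.E₃₄ * E.D.symm S.E₃₄ ≠ 0 := by positivity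
  refine (mul_eq_zero.1 ?_).resolve_left this
  rw [delta] at hHΔ
  linear_combination hHΔ + (S.E₂₂ * S.E₃₄ - S.E₂₄ * S.E₃₂) * E.D.symm S.E₃₄ * e₁ +
    S.E₂₄ * S.E₁₂ * E.D.symm S.E₃₄ * e₃ + S.E₂₃ * S.E₁₂ * S.E₃₄ * hV

theorem Solves.eq (h₁₂ : S.E₁₂ ≠ 0) (h₃₄ : S.E₃₄ ≠ 0) (hΔ : S.delta ≠ 0) {u y : E.FunField}
    (h : S.Solves u y) : S.Condition ∧ u = S.H ∧ y = S.V := by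
  have h₃₄' : E.D.symm S.E₃₄ ≠ 0 := by simpa using h₃₄
  obtain ⟨e₁, e₂, e₃⟩ := h
  -- Applying `D⁻¹` to the third equation gives a relation between the unshifted `u` and `y`.
  have hV : y * E.D.symm S.E₃₄ = E.D.symm S.F₃ - E.D.symm S.E₃₂ * u := by
    have := congrArg E.D.symm e₃
    simp only [map_sub, map_add, map_mul, RingEquiv.symm_apply_apply, map_zero] at this
    linear_combination this
  have hu : u = S.H := by
    rw [H, eq_div_iff hΔ, delta]
    linear_combination S.E₁₂ * S.E₃₄ * E.D.symm S.E₃₄ * e₂ -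
      ((S.E₂₂ * S.E₃₄ - S.E₂₄ * S.E₃₂) * E.D.symm S.E₃₄ * e₁ +
      S.E₂₄ * S.E₁₂ * E.D.symm S.E₃₄ * e₃ + S.E₂₃ * S.E₁₂ * S.E₃₄ * hV)
  subst hu
  refine ⟨⟨hΔ, ?_⟩, rfl, by rw [V, eq_div_iff h₃₄', hV]⟩
  field_simp
  linear_combination e₁

end DiffSystem

/-- `B = y C₂ + u Z₁` is equivalent, after conjugation by the shift, to the system `S` for
`u` and `y`. -/
structure DiffSystem.Governs (S : E.DiffSystem) (B : E.VectorField) : Prop where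
  geometric : B ∈ E.geometric
  x : B (E.coord .x) = 0
  tx : B (E.coord .tx) = 0
  t_zero : B (E.coord (.t 0)) = 0
  isConj : ∃ c : E.FunField, c ≠ 0 ∧ ∀ u y : E.FunField, ∃ e : E.FunField, IsConj (B - y • E.C₂ - u • E.Z₁)
    (c • (B - y • E.C₂ - u • E.Z₁) +
      ((S.E₁₁ * u + S.E₁₂ * E.D u - S.F₁) / E.f_tx) • E.Z₁ +
      ((S.E₂₂ * E.D u + S.E₂₃ * y + S.E₂₄ * E.D y - S.F₂) / E.f_tx) • E.C₂ +
      ((S.E₃₂ * E.D u + S.E₃₄ * E.D y - S.F₃) / E.f_tx ^ 2) • E.C₁ + e • E.X)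

/-- When the three equations hold, the conjugate of `B - y C₂ - u Z₁` reduces to a multiple of
itself plus a multiple of `X`, so rigidity applies. -/
theorem DiffSystem.Governs.eq_of_solves {S : E.DiffSystem} {B : E.VectorField} (hB : S.Governs B)
    {u y : E.FunField} (h : S.Solves u y) : B = y • E.C₂ + u • E.Z₁ := by
  obtain ⟨c, hc, hconj⟩ := hB.isConj
  obtain ⟨e, he⟩ := hconj u y
  obtain ⟨h₁, h₂, h₃⟩ := h
  simp only [h₁, h₂, h₃, zero_div, zero_smul, add_zero] at he
  rw [← sub_eq_zero, ← sub_sub]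
  refine eq_zero_of_isConj ?_ ?_ ?_ ?_ hc he
  · exact E.geometric.sub_mem (E.geometric.sub_mem hB.geometric
      (E.geometric.smul_mem _ C₂_mem_geometric)) (E.geometric.smul_mem _ Z₁_mem_geometric)
  · simp [hB.x]
  · simp [hB.tx]
  · simp [hB.t_zero]

theorem eq_zero_of_linearIndependent
    (h : LinearIndependent E.FunField ![E.X, E.K, E.C₁, E.C₂, E.Z₁]) {a₀ a₁ a₂ a₃ a₄ : E.FunField}
    (h0 : a₀ • E.X + a₁ • E.K + a₂ • E.C₁ + a₃ • E.C₂ + a₄ • E.Z₁ = 0) :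
    a₀ = 0 ∧ a₁ = 0 ∧ a₂ = 0 ∧ a₃ = 0 ∧ a₄ = 0 := by
  have := Fintype.linearIndependent_iff.1 h ![a₀, a₁, a₂, a₃, a₄]
    (by simpa [Fin.sum_univ_five] using h0)
  exact ⟨this 0, this 1, this 2, this 3, this 4⟩

/-- Conversely the conjugate of `0` is `0`, and independence makes each coefficient vanish
separately. -/
theorem DiffSystem.Governs.solves_of_eq {S : E.DiffSystem} {B : E.VectorField} (hB : S.Governs B)
    (hu : E.f_tx ≠ 0) (hli : LinearIndependent E.FunField ![E.X, E.K, E.C₁, E.C₂, E.Z₁])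
    {u y : E.FunField} (h : B = y • E.C₂ + u • E.Z₁) : S.Solves u y := by
  obtain ⟨c, hc, hconj⟩ := hB.isConj
  obtain ⟨e, he⟩ := hconj u y
  rw [show B - y • E.C₂ - u • E.Z₁ = 0 by rw [h]; abel] at he
  have h0 := he.eq_zero
  obtain ⟨-, -, h₃, h₂, h₁⟩ := eq_zero_of_linearIndependent hli (a₀ := e) (a₁ := 0)
    (a₂ := (S.E₃₂ * E.D u + S.E₃₄ * E.D y - S.F₃) / E.f_tx ^ 2)
    (a₃ := (S.E₂₂ * E.D u + S.E₂₃ * y + S.E₂₄ * E.D y - S.F₂) / E.f_tx)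
    (a₄ := (S.E₁₁ * u + S.E₁₂ * E.D u - S.F₁) / E.f_tx) (by rw [← h0]; module)
  exact ⟨(div_eq_zero_iff.1 h₁).resolve_right hu, (div_eq_zero_iff.1 h₂).resolve_right hu,
    (div_eq_zero_iff.1 h₃).resolve_right (pow_ne_zero _ hu)⟩

/-! ### The three systems -/

/-- The coefficient of `X` is left existential: it is invisible on the `t_k` and plays no role in
rigidity. -/
theorem exists_lie_inv_smul_X (a b d : E.FunField) : ∃ e : E.FunField,
    ⁅E.f_tx⁻¹ • E.X, a • E.C₂ + b • E.C₁ + d • E.X⁆ =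
      (a / E.f_tx) • ⁅E.X, E.C₂⁆ + ((E.X a + b) / E.f_tx) • E.C₂ + (E.X b / E.f_tx) • E.C₁ +
        e • E.X := by
  refine ⟨E.f_tx⁻¹ * E.X d + E.f_tx⁻¹ ^ 2 * (a • E.C₂ + b • E.C₁ + d • E.X) E.f_tx, ?_⟩
  simp only [lie_inv_smul_X, lie_add, lie_smul_eq, lie_X_C₁, lie_self, Derivation.add_apply,
    Derivation.smul_apply, smul_eq_mul]
  module

theorem exists_lie_K_sub_smul_X (c a b d : E.FunField) : ∃ e : E.FunField,
    ⁅E.K - E.p • E.X, c • E.Z₁ + a • E.C₂ + b • E.C₁ + d • E.X⁆ =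
      c • ⁅E.K, E.Z₁⁆ + (a - E.p * c) • ⁅E.K, E.C₂⁆ - (E.p * a) • ⁅E.X, E.C₂⁆ +
        ((E.K - E.p • E.X) c + b) • E.Z₁ + ((E.K - E.p • E.X) a - E.p * b) • E.C₂ +
        ((E.K - E.p • E.X) b - d) • E.C₁ + e • E.X := by
  refine ⟨(E.K - E.p • E.X) d + (c • E.Z₁ + a • E.C₂ + b • E.C₁ + d • E.X) E.p, ?_⟩
  simp only [lie_K_sub_smul_X, lie_add, lie_smul_eq, lie_X_C₁, lie_K_C₁, lie_X_Z₁, lie_K_X,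
    lie_self, Derivation.add_apply, Derivation.sub_apply, Derivation.smul_apply, smul_eq_mul]
  module

theorem governs_system₁ (hu : E.f_tx ≠ 0) : E.system₁.Governs ⁅E.X, E.C₂⁆ where
  geometric := lie_mem_geometric X_mem_geometric C₂_mem_geometric
  x := by simp [Derivation.commutator_apply]
  tx := by simp [Derivation.commutator_apply]
  t_zero := by simp [Derivation.commutator_apply]
  isConj := by
    -- The factor is the product of the leading coefficients `1/f_tx` and `1/f_tx²` of the
    -- conjugates of `X` and `C₂`.
    refine ⟨1 / E.f_tx ^ 3, one_div_ne_zero (pow_ne_zero _ hu), fun u y => ?_⟩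
    obtain ⟨e, he⟩ := exists_lie_inv_smul_X (E := E) (1 / E.f_tx ^ 2) (-E.f_txtx / E.f_tx ^ 3)
      (E.f_txtx * E.f_t / E.f_tx ^ 4)
    refine ⟨e - E.D y * (E.f_txtx * E.f_t / E.f_tx ^ 4) -
      E.D u * ((E.w - E.v - E.p * E.f_txtx) * E.f_t / E.f_tx ^ 3),
      ((((isConj_X hu).lie (isConj_C₂ hu)).sub ((isConj_C₂ hu).smul y)).sub
        ((isConj_Z₁ hu).smul u)).congr_right ?_⟩
    simp only [he, apply_div_pow _ _ hu, map_neg, Derivation.map_one_eq_zero, X_f_tx, X_f_txtx,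
      system₁, h]
    match_scalars <;> field_simp <;> ring

/-- The relation for `[X, C₂]` is needed because conjugating `K` produces a term `-p [X, C₂]`; this
is how `α` and `β` enter the right-hand sides. -/
theorem governs_system₂ (hu : E.f_tx ≠ 0) (h₁ : ⁅E.X, E.C₂⁆ = E.α • E.C₂ + E.β • E.Z₁) :
    E.system₂.Governs ⁅E.K, E.C₂⁆ where
  geometric := lie_mem_geometric K_mem_geometric C₂_mem_geometric
  x := by simp [Derivation.commutator_apply]
  tx := by simp [Derivation.commutator_apply]
  t_zero := by simp [Derivation.commutator_apply]
  isConj := by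
    refine ⟨1 / E.f_tx ^ 2, one_div_ne_zero (pow_ne_zero _ hu), fun u y => ?_⟩
    obtain ⟨e, he⟩ := exists_lie_K_sub_smul_X (E := E) 0 (1 / E.f_tx ^ 2)
      (-E.f_txtx / E.f_tx ^ 3) (E.f_txtx * E.f_t / E.f_tx ^ 4)
    rw [zero_smul, zero_add] at he
    refine ⟨e - E.D y * (E.f_txtx * E.f_t / E.f_tx ^ 4) -
      E.D u * ((E.w - E.v - E.p * E.f_txtx) * E.f_t / E.f_tx ^ 3),
      ((((isConj_K hu).lie (isConj_C₂ hu)).sub ((isConj_C₂ hu).smul y)).sub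
        ((isConj_Z₁ hu).smul u)).congr_right ?_⟩
    simp only [he, h₁, apply_div_pow _ _ hu, map_neg, Derivation.map_one_eq_zero, map_zero,
      Derivation.sub_apply, Derivation.smul_apply, smul_eq_mul, X_f_tx, X_f_txtx, K_f_tx,
      system₂, h, ← K_f_txtx]
    match_scalars <;> field_simp <;> ring

theorem governs_system₃ (hu : E.f_tx ≠ 0) (h₁ : ⁅E.X, E.C₂⁆ = E.α • E.C₂ + E.β • E.Z₁)
    (h₂ : ⁅E.K, E.C₂⁆ = E.γ • E.C₂ + E.μ • E.Z₁) :
    E.system₃.Governs ⁅E.K, E.Z₁⁆ where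
  geometric := lie_mem_geometric K_mem_geometric Z₁_mem_geometric
  x := by simp [Derivation.commutator_apply]
  tx := by simp [Derivation.commutator_apply]
  t_zero := by simp [Derivation.commutator_apply]
  isConj := by
    refine ⟨1 / E.f_tx, one_div_ne_zero hu, fun u y => ?_⟩
    -- The combination is made opaque because `F₃` contains `K - p X` applied to it, and that
    -- derivative must stay unexpanded on both sides.
    obtain ⟨a, ha⟩ : ∃ a, a = E.w - E.v - E.p * E.f_txtx := ⟨_, rfl⟩
    have hZ : IsConj E.Z₁ ((1 / E.f_tx ^ 1) • E.Z₁ + (-E.p / E.f_tx ^ 1) • E.C₂ +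
        (-a / E.f_tx ^ 2) • E.C₁ + (a * E.f_t / E.f_tx ^ 3) • E.X) :=
      (isConj_Z₁ hu).congr_right (by rw [ha, pow_one, one_div])
    obtain ⟨e, he⟩ := exists_lie_K_sub_smul_X (E := E) (1 / E.f_tx ^ 1) (-E.p / E.f_tx ^ 1)
      (-a / E.f_tx ^ 2) (a * E.f_t / E.f_tx ^ 3)
    refine ⟨e - E.D y * (E.f_txtx * E.f_t / E.f_tx ^ 4) - E.D u * (a * E.f_t / E.f_tx ^ 3),
      ((((isConj_K hu).lie hZ).sub ((isConj_C₂ hu).smul y)).sub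
        (hZ.smul u)).congr_right ?_⟩
    have ha' : E.f_txtx * E.p + E.v - E.w = -a := by rw [ha]; ring
    simp only [he, h₁, h₂, apply_div_pow _ _ hu, map_neg, Derivation.map_one_eq_zero,
      Derivation.sub_apply, Derivation.smul_apply, smul_eq_mul, X_f_tx, K_f_tx, X_p hu,
      system₃, ha',
      show -E.f_txtx * E.p - E.v + E.w = a by rw [ha]; ring]
    match_scalars <;> field_simp <;> (try rw [ha]) <;> ring

/-! ### Linear independence -/

variable (E) in
/-- Up to a nonzero factor, the determinant of `C₂` and `Z₁` in the directions `t_1`, `t_{-1}`. -/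
noncomputable def minor : E.FunField :=
  E.f_txtx * E.D.symm (E.w - E.v - E.p * E.f_txtx) -
    (E.w - E.v) * E.D.symm (E.f_txtx / E.f_tx)

/-- The three systems differ in `E₁₁` and `E₂₃` only by a common power of `f_tx`, so their
determinants are proportional. -/
theorem delta_system₁ : E.system₁.delta = 1 / E.f_tx ^ 2 * (1 / E.f_tx) * E.minor := by
  simp only [DiffSystem.delta, system₁, minor, map_sub, map_mul, map_div₀]
  ring

theorem delta_system₂ : E.system₂.delta = 1 / E.f_tx * (1 / E.f_tx) * E.minor := by
  simp only [DiffSystem.delta, system₂, minor, map_sub, map_mul, map_div₀]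
  ring

theorem delta_system₃ : E.system₃.delta = 1 / E.f_tx * E.minor := by
  simp only [DiffSystem.delta, system₃, minor, map_sub, map_mul, map_div₀, map_add, map_neg]
  ring

/-- The values at `x`, `t_x`, `t` remove `K`, `X`, `C₁`. For `C₂` and `Z₁` the values at `t_1` and,
through the conjugate, at `t_{-1}` form a 2×2 system with determinant `minor` up to a nonzero
factor. -/
theorem linearIndependent_of_minor_ne_zero (hu : E.f_tx ≠ 0) (h : E.minor ≠ 0) :
    LinearIndependent E.FunField ![E.X, E.K, E.C₁, E.C₂, E.Z₁] := by
  refine Fintype.linearIndependent_iff.2 fun a ha => ?_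
  simp only [Fin.sum_univ_five] at ha
  change a 0 • E.X + a 1 • E.K + a 2 • E.C₁ + a 3 • E.C₂ + a 4 • E.Z₁ = 0 at ha
  have h1 : a 1 = 0 := by simpa using DFunLike.congr_fun ha (E.coord .x)
  have h0 : a 0 = 0 := by simpa using DFunLike.congr_fun ha (E.coord .tx)
  have h2 : a 2 = 0 := by simpa [h1] using DFunLike.congr_fun ha (E.coord (.t 0))
  rw [h0, h1, h2, zero_smul, zero_smul, zero_smul, zero_add, zero_add, zero_add] at ha
  have e₁ : a 3 * E.f_txtx + a 4 * (E.w - E.v) = 0 := by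
    simpa using DFunLike.congr_fun ha (E.coord (.t 1))
  have hconj := ((isConj_C₂ hu).smul (a 3)).add ((isConj_Z₁ hu).smul (a 4))
  rw [ha] at hconj
  -- Evaluating the conjugate at `t = D t_{-1}` amounts to evaluating the original combination at
  -- `t_{-1}`.
  have e₂ : a 3 * E.D.symm (E.f_txtx / E.f_tx) +
      a 4 * E.D.symm (E.w - E.v - E.p * E.f_txtx) = 0 := by
    have e := DFunLike.congr_fun hconj.eq_zero (E.coord (.t 0))
    simp only [Derivation.add_apply, Derivation.smul_apply, smul_eq_mul, C₂_t_zero, C₁_t_zero,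
      Z₁_t_zero, X_t, Derivation.zero_apply] at e
    apply E.D.injective
    simp only [map_add, map_mul, RingEquiv.apply_symm_apply, map_zero]
    field_simp at e ⊢
    refine mul_left_cancel₀ hu ?_
    linear_combination -e
  have h4 : a 4 = 0 := (mul_eq_zero.1 (show a 4 * E.minor = 0 by
    rw [minor]
    linear_combination E.f_txtx * e₂ - E.D.symm (E.f_txtx / E.f_tx) * e₁)).resolve_right h
  have h3 : a 3 = 0 := (mul_eq_zero.1 (show a 3 * E.minor = 0 by
    rw [minor]
    linear_combination E.D.symm (E.w - E.v - E.p * E.f_txtx) * e₁ -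
      (E.w - E.v) * e₂)).resolve_right h
  intro i
  fin_cases i
  exacts [h0, h1, h2, h3, h4]

/-- If `minor` vanished, `Z₁ - l C₂`, with `l` chosen to kill its value at `t_1`, would be conjugate
to `f_tx⁻¹` times itself plus a multiple of `X`. Rigidity would make it zero, contradicting
independence. -/
theorem minor_ne_zero (hf : E.f_txtx ≠ 0)
    (hli : LinearIndependent E.FunField ![E.X, E.K, E.C₁, E.C₂, E.Z₁]) : E.minor ≠ 0 := by
  intro h
  have hu := f_tx_ne_zero hf
  have hu' : E.D.symm E.f_tx ≠ 0 := by simpa using hu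
  obtain ⟨l, hl⟩ : ∃ l, l = (E.w - E.v) / E.f_txtx := ⟨_, rfl⟩
  have hl₁ : l * E.f_txtx = E.w - E.v := by rw [hl, div_mul_cancel₀ _ hf]
  -- This is the vanishing of `minor` after applying `D`: the same `l` also kills the value at
  -- `t_{-1}`.
  have hDl : E.D l * E.f_txtx = (E.w - E.v - E.p * E.f_txtx) * E.f_tx := by
    apply E.D.symm.injective
    simp only [map_mul, RingEquiv.symm_apply_apply]
    apply mul_left_cancel₀ hf
    rw [minor, map_div₀, sub_eq_zero, mul_div_assoc', eq_div_iff hu'] at h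
    linear_combination (E.D.symm E.f_txtx) * hl₁ - h
  have hW : E.Z₁ - l • E.C₂ = 0 := by
    refine eq_zero_of_isConj (c := 1 / E.f_tx) (e := (E.w - E.v - E.p * E.f_txtx) * E.f_t /
      E.f_tx ^ 3 - E.D l * (E.f_txtx * E.f_t / E.f_tx ^ 4))
      (E.geometric.sub_mem Z₁_mem_geometric (E.geometric.smul_mem _ C₂_mem_geometric))
      (by simp) (by simp) (by simp) (one_div_ne_zero hu) ?_
    have hconj := (isConj_Z₁ hu).sub ((isConj_C₂ hu).smul l)
    have hy : -E.p / E.f_tx - E.D l * (1 / E.f_tx ^ 2) = -l / E.f_tx := by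
      field_simp
      apply mul_right_cancel₀ hf
      linear_combination E.f_tx * hl₁ - hDl
    refine hconj.congr_right ?_
    have hc : -(E.w - E.v - E.p * E.f_txtx) / E.f_tx ^ 2 -
        E.D l * (-E.f_txtx / E.f_tx ^ 3) = 0 := by
      field_simp
      linear_combination hDl
    linear_combination (norm := module) hc • E.C₁ + hy • E.C₂
  obtain ⟨-, -, -, -, h1⟩ := eq_zero_of_linearIndependent hli (a₀ := 0) (a₁ := 0) (a₂ := 0)
    (a₃ := -l) (a₄ := 1) (by rw [← hW]; module)
  exact one_ne_zero h1

/-! ### The characteristic ring -/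

theorem X_mem_charRing : E.X ∈ E.charRing :=
  Submodule.mem_sInf.2 fun _ h => h.1

theorem K_mem_charRing : E.K ∈ E.charRing :=
  Submodule.mem_sInf.2 fun _ h => h.2.1

theorem lie_mem_charRing {V W : E.VectorField} (hV : V ∈ E.charRing) (hW : W ∈ E.charRing) :
    ⁅V, W⁆ ∈ E.charRing :=
  Submodule.mem_sInf.2 fun L h =>
    h.2.2 V (Submodule.mem_sInf.1 hV L h) W (Submodule.mem_sInf.1 hW L h)

theorem C₁_mem_charRing : E.C₁ ∈ E.charRing := lie_mem_charRing X_mem_charRing K_mem_charRing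

theorem C₂_mem_charRing : E.C₂ ∈ E.charRing := lie_mem_charRing X_mem_charRing C₁_mem_charRing

theorem Z₁_mem_charRing : E.Z₁ ∈ E.charRing := lie_mem_charRing K_mem_charRing C₁_mem_charRing

theorem lie_mem_span {s : Set E.VectorField} {V : E.VectorField}
    (h : ∀ W ∈ s, ⁅V, W⁆ ∈ Submodule.span E.FunField s) {W : E.VectorField}
    (hW : W ∈ Submodule.span E.FunField s) : ⁅V, W⁆ ∈ Submodule.span E.FunField s := by
  induction hW using Submodule.span_induction with
  | mem W hW => exact h W hW
  | zero => simp
  | add W W' _ _ h h' => rw [lie_add]; exact add_mem h h'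
  | smul a W hW h =>
    rw [lie_smul_eq]
    exact add_mem (Submodule.smul_mem _ _ h) (Submodule.smul_mem _ _ hW)

theorem forall_mem_range_iff {P : E.VectorField → Prop} {V₀ V₁ V₂ V₃ V₄ : E.VectorField} :
    (∀ V ∈ Set.range ![V₀, V₁, V₂, V₃, V₄], P V) ↔ P V₀ ∧ P V₁ ∧ P V₂ ∧ P V₃ ∧ P V₄ := by
  simp only [Matrix.range_cons, Matrix.range_empty, Set.union_empty, Set.mem_union,
    Set.mem_singleton_iff, or_imp, forall_and, forall_eq]

/-- The fields whose bracket maps the span into itself are closed under brackets by Jacobi. They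
include `X` and `K` by the three relations, hence also `C₁`, `C₂`, `Z₁`; the Leibniz rule then
handles arbitrary coefficients. -/
theorem charRing_eq_span {a₁ b₁ a₂ b₂ a₃ b₃ : E.FunField}
    (h₁ : ⁅E.X, E.C₂⁆ = a₁ • E.C₂ + b₁ • E.Z₁) (h₂ : ⁅E.K, E.C₂⁆ = a₂ • E.C₂ + b₂ • E.Z₁)
    (h₃ : ⁅E.K, E.Z₁⁆ = a₃ • E.C₂ + b₃ • E.Z₁) :
    E.charRing = Submodule.span E.FunField (Set.range ![E.X, E.K, E.C₁, E.C₂, E.Z₁]) := by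
  set S := Submodule.span E.FunField (Set.range ![E.X, E.K, E.C₁, E.C₂, E.Z₁]) with hS
  obtain ⟨mX, mK, mC₁, mC₂, mZ₁⟩ := forall_mem_range_iff.1
    (fun V hV => Submodule.subset_span hV : ∀ V ∈ Set.range ![E.X, E.K, E.C₁, E.C₂, E.Z₁], V ∈ S)
  have comb (a b : E.FunField) : a • E.C₂ + b • E.Z₁ ∈ S :=
    add_mem (S.smul_mem _ mC₂) (S.smul_mem _ mZ₁)
  have hX : ∀ W ∈ S, ⁅E.X, W⁆ ∈ S := fun W hW => lie_mem_span (forall_mem_range_iff.2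
    ⟨by simp, mC₁, mC₂, by rw [h₁]; exact comb _ _, by rw [lie_X_Z₁, h₂]; exact comb _ _⟩) hW
  have hK : ∀ W ∈ S, ⁅E.K, W⁆ ∈ S := fun W hW => lie_mem_span (forall_mem_range_iff.2
    ⟨by rw [lie_K_X]; exact neg_mem mC₁, by simp, mZ₁, by rw [h₂]; exact comb _ _,
      by rw [h₃]; exact comb _ _⟩) hW
  have hlie {V V' : E.VectorField} (hV : ∀ W ∈ S, ⁅V, W⁆ ∈ S) (hV' : ∀ W ∈ S, ⁅V', W⁆ ∈ S) :
      ∀ W ∈ S, ⁅⁅V, V'⁆, W⁆ ∈ S := fun W hW => by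
    rw [lie_lie]
    exact sub_mem (hV _ (hV' _ hW)) (hV' _ (hV _ hW))
  have hC₁ := hlie hX hK
  refine le_antisymm (sInf_le ⟨mX, mK, fun V hV W hW => ?_⟩) ?_
  -- Skew-symmetry, used twice, reduces the first argument to a generator, as was done above for the
  -- second.
  · rw [← lie_skew]
    refine neg_mem (lie_mem_span (fun V' hV' => ?_) hV)
    rw [← lie_skew]
    refine neg_mem ?_
    revert V'
    exact forall_mem_range_iff.2
      ⟨hX W hW, hK W hW, hC₁ W hW, hlie hX hC₁ W hW, hlie hK hC₁ W hW⟩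
  · rw [hS, Submodule.span_le]
    exact forall_mem_range_iff.2
      ⟨X_mem_charRing, K_mem_charRing, C₁_mem_charRing, C₂_mem_charRing, Z₁_mem_charRing⟩

/-- A vector field in the span of `X, K, C₁, C₂, Z₁` that kills `x`, `t_x`, `t` is a combination of
`C₂` and `Z₁`. -/
theorem exists_eq_smul_add_smul {B : E.VectorField} {S : E.DiffSystem} (hB : S.Governs B)
    (h : B ∈ Submodule.span E.FunField (Set.range ![E.X, E.K, E.C₁, E.C₂, E.Z₁])) :
    ∃ u y : E.FunField, B = y • E.C₂ + u • E.Z₁ := by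
  obtain ⟨c, rfl⟩ := (Submodule.mem_span_range_iff_exists_fun _).1 h
  have hx := hB.x
  have htx := hB.tx
  have ht := hB.t_zero
  simp only [Fin.sum_univ_five] at hx htx ht ⊢
  change (c 0 • E.X + c 1 • E.K + c 2 • E.C₁ + c 3 • E.C₂ + c 4 • E.Z₁) (E.coord .x) = 0 at hx
  change (c 0 • E.X + c 1 • E.K + c 2 • E.C₁ + c 3 • E.C₂ + c 4 • E.Z₁) (E.coord .tx) = 0 at htx
  change (c 0 • E.X + c 1 • E.K + c 2 • E.C₁ + c 3 • E.C₂ + c 4 • E.Z₁) (E.coord (.t 0)) = 0 at ht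
  have h1 : c 1 = 0 := by simpa using hx
  have h0 : c 0 = 0 := by simpa using htx
  have h2 : c 2 = 0 := by simpa [h1] using ht
  refine ⟨c 4, c 3, ?_⟩
  change c 0 • E.X + c 1 • E.K + c 2 • E.C₁ + c 3 • E.C₂ + c 4 • E.Z₁ = _
  simp [h0, h1, h2]

/-! ### The criterion -/

theorem DiffSystem.Governs.condition {S : E.DiffSystem} {B : E.VectorField} (hB : S.Governs B)
    (hu : E.f_tx ≠ 0) (h₁₂ : S.E₁₂ ≠ 0) (h₃₄ : S.E₃₄ ≠ 0) (hΔ : S.delta ≠ 0)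
    (hli : LinearIndependent E.FunField ![E.X, E.K, E.C₁, E.C₂, E.Z₁])
    (h : B ∈ Submodule.span E.FunField (Set.range ![E.X, E.K, E.C₁, E.C₂, E.Z₁])) :
    S.Condition ∧ B = S.V • E.C₂ + S.H • E.Z₁ := by
  obtain ⟨u, y, hy⟩ := exists_eq_smul_add_smul hB h
  obtain ⟨hc, rfl, rfl⟩ := (hB.solves_of_eq hu hli hy).eq h₁₂ h₃₄ hΔ
  exact ⟨hc, hy⟩

theorem condition_iff (hf : E.f_txtx ≠ 0) :
    (LinearIndependent E.FunField ![E.X, E.K, E.C₁, E.C₂, E.Z₁] ∧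
      E.charRing = Submodule.span E.FunField (Set.range ![E.X, E.K, E.C₁, E.C₂, E.Z₁])) ↔
    (E.system₁.Condition ∧ E.system₂.Condition ∧ E.system₃.Condition) := by
  have hu := f_tx_ne_zero hf
  have h₁₂ : (-1 : E.FunField) ≠ 0 := neg_ne_zero.2 one_ne_zero
  have h₃₄ : E.f_txtx / E.f_tx ≠ 0 := div_ne_zero hf hu
  constructor
  · rintro ⟨hli, hspan⟩
    have hm := minor_ne_zero hf hli
    have hu₁ := one_div_ne_zero hu
    have hmem {V W : E.VectorField} (hV : V ∈ E.charRing) (hW : W ∈ E.charRing) :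
        ⁅V, W⁆ ∈ Submodule.span E.FunField (Set.range ![E.X, E.K, E.C₁, E.C₂, E.Z₁]) :=
      hspan ▸ lie_mem_charRing hV hW
    obtain ⟨c₁, e₁⟩ := (governs_system₁ hu).condition hu h₁₂ h₃₄
      (delta_system₁ (E := E) ▸
        mul_ne_zero (mul_ne_zero (one_div_ne_zero (pow_ne_zero _ hu)) hu₁) hm)
      hli (hmem X_mem_charRing C₂_mem_charRing)
    -- The order matters: the coefficients of each system use the solutions of the earlier ones,
    -- here identified by `e₁`.
    obtain ⟨c₂, e₂⟩ := (governs_system₂ hu e₁).condition hu h₁₂ h₃₄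
      (delta_system₂ (E := E) ▸ mul_ne_zero (mul_ne_zero hu₁ hu₁) hm)
      hli (hmem K_mem_charRing C₂_mem_charRing)
    obtain ⟨c₃, -⟩ := (governs_system₃ hu e₁ e₂).condition hu h₁₂ h₃₄
      (delta_system₃ (E := E) ▸ mul_ne_zero hu₁ hm) hli (hmem K_mem_charRing Z₁_mem_charRing)
    exact ⟨c₁, c₂, c₃⟩
  · rintro ⟨c₁, c₂, c₃⟩
    have e₁ := (governs_system₁ hu).eq_of_solves (c₁.solves h₁₂ h₃₄)
    have e₂ := (governs_system₂ hu e₁).eq_of_solves (c₂.solves h₁₂ h₃₄)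
    have e₃ := (governs_system₃ hu e₁ e₂).eq_of_solves (c₃.solves h₁₂ h₃₄)
    refine ⟨linearIndependent_of_minor_ne_zero hu ?_, charRing_eq_span e₁ e₂ e₃⟩
    -- Any one of the three determinants would do, each being a multiple of `minor`.
    have hΔ := c₃.1
    rw [delta_system₃] at hΔ
    exact right_ne_zero_of_mul hΔ

end SemiDiscreteEquation

/-! ### Bases of a submodule and the main theorem -/

theorem exists_basis_submodule_iff {ι R M : Type*} [Ring R] [AddCommGroup M]
    [Module R M] (N : Submodule R M) (v : ι → M) :
    (∃ b : Module.Basis ι R N, ∀ i, (b i : M) = v i) ↔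
      LinearIndependent R v ∧ N = Submodule.span R (Set.range v) := by
  constructor
  · rintro ⟨b, hb⟩
    obtain rfl : N.subtype ∘ b = v := funext hb
    refine ⟨b.linearIndependent.map' _ N.ker_subtype, ?_⟩
    rw [Set.range_comp, Submodule.span_image, b.span_eq, Submodule.map_subtype_top]
  · rintro ⟨hv, rfl⟩
    exact ⟨Module.Basis.span hv, fun i => congrArg Subtype.val (Module.Basis.span_apply hv i)⟩

/-- Criterion for the characteristic `x`-ring of `t_{1x} = f(x, t, t_1, t_x)`, `f_{t_x t_x} ≠ 0`, to
be five-dimensional with basis `X, K, C₁, C₂, Z₁`. -/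
theorem mainTheorem1 {𝕜 : Type*} [RCLike 𝕜] (E : SemiDiscreteEquation 𝕜) (hf : E.f_txtx ≠ 0) :
    (∃ b : Module.Basis (Fin 5) E.FunField E.charRing,
      ∀ i, (b i : E.VectorField) = ![E.X, E.K, E.C₁, E.C₂, E.Z₁] i) ↔
    (E.system₁.Condition ∧ E.system₂.Condition ∧ E.system₃.Condition) := by
  rw [exists_basis_submodule_iff, SemiDiscreteEquation.condition_iff hf]
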